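/- Let $p(z)=a_dz^d+\dots+a_1z+a_0\in\mathbb{Z}[z]$ with $d\ge 1$ and $a_d>0$, and suppose that $2\mid p(1)p(2)$. For a 2-colouring $\phi$ of $[n]=\{1,\dots,n\}$, a monochromatic solution to $x+y=p(z)$ is a three-element set $\{x,y,z\}\subseteq[n]$ such that $x+y=p(z)$ and $\phi(x)=\phi(y)=\phi(z)$. (1) There is a function $\varepsilon:\mathbb{N}\to\mathbb{R}$, depending only on $p$, with $\varepsilon(n)\to0$ as $n\to\infty$, such that for all sufficiently large $n$ every 2-colouring of $[n]$ has at least $n^{2/d^3-\varepsilon(n)}$ monochromatic solutions to $x+y=p(z)$. (2) There is a constant $C$, depending only on $p$, such that for every $n\ge1$ there is a 2-colouring of $[n]$ with at most $C\,n^{2/d^2}$ monochromatic solutions to $x+y=p(z)$; for the same colouring, the number of ordered triples $(x,y,z)\in[n]^3$, not necessarily with distinct entries, with $x+y=p(z)$ and $\phi(x)=\phi(y)=\phi(z)$ is also at most $C\,n^{2/d^2}$. -/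

import Mathlib

open Classical in
/-- The monochromatic solutions `{x, y, z}` of `x + y = p(z)` in `[n] = {1, …, n}`, as a family of
three-element subsets of `[n]` (so `x`, `y`, `z` are distinct and each set is counted once).
A 2-colouring of `[n]` is the restriction to `[n]` of a function `φ : ℕ → Bool`; values of `φ`
outside `[n]` play no role. -/
noncomputable def monoSolutionSets (p : Polynomial ℤ) (n : ℕ) (φ : ℕ → Bool) :
    Finset (Finset ℕ) :=
  {S ∈ (Finset.Icc 1 n).powersetCard 3 |
    ∃ x y z : ℕ, S = {x, y, z} ∧ φ x = φ y ∧ φ y = φ z ∧ (x : ℤ) + (y : ℤ) = p.eval (z : ℤ)}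

open Classical in
/-- The monochromatic solutions of `x + y = p(z)` in `[n]` as ordered triples `(x, y, z)`, with
repetitions among `x`, `y`, `z` allowed. -/
noncomputable def monoSolutionTriples (p : Polynomial ℤ) (n : ℕ) (φ : ℕ → Bool) :
    Finset (ℕ × ℕ × ℕ) :=
  {t ∈ Finset.Icc 1 n ×ˢ Finset.Icc 1 n ×ˢ Finset.Icc 1 n |
    φ t.1 = φ t.2.1 ∧ φ t.2.1 = φ t.2.2 ∧ (t.1 : ℤ) + (t.2.1 : ℤ) = p.eval (t.2.2 : ℤ)}

/-! ### Periodicity from shift-closed predicates -/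

/-! Lower bound, degree `d ≥ 2`. If a colouring has few solutions, all `z` in a suitable range
outside a sparse set `Z` are clean: they are the `z` of no monochromatic solution with distinct
entries. For clean `r` and `x` of the colour of `r`, the partner `p r - x` has the other colour.
Comparing clean `r`, `b` of different colours, the colour class of `r` is therefore closed under `x
↦ x + (p b - p r)`, as long as `x` stays in range (`Avoids.shift`). This one observation is used in
three stages.

Three suitably spaced clean elements with alternating colours give a shift up and a shift down, so
the colouring is periodic on a long interval. The minimal period `P` divides all differences of `p`
at clean points, hence divides `d! a_d`, and the parity condition on `p 1 * p 2` makes `2 s ≡ p a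
(mod P)` solvable. Pairs inside the class of `s` then produce a solution (`Avoids.no_alternation`,
`period_bound`).

A change of colour between neighbouring clean elements must then be a single change: one colour
below, the other above. The shifts generate a submonoid which, by finite differences of `p` with
steps `2^J, ..., 2, 1`, approximates every large integer with error less than `d! a_d`. Starting
from a run of that many equally coloured integers, some `p w` becomes a sum of two integers of the
colour of `w` (`no_single_change`, `no_flip`).

So all clean elements between `A` and `M ≈ A^d` have one colour, and a solution among them is
immediate (`not_sparse`). Cleanness up to `2 M` needs `n` of order `A^(d²)`, whence at least
`n^(1/d²)` solutions up to logarithms; this suffices because `2/d³ ≤ 1/d²`.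

Degree one needs order `n²` solutions, so a counting version is used. Each change of colour at
distance `2 s` forces a solution given by linear forms in its data (`exists_solution_of_ne`), with
boundedly many changes per solution. Few solutions thus mean few changes, hence one colour for
almost all elements of a parity class, hence many solutions after all.

Upper bound: with `T₂ ≈ n^(1/d)`, colour `{x ≤ T₂ : p x > 2 T₂}` against the rest. In a
monochromatic solution `z` and one summand are then at most `T₁ ≈ n^(1/d²)`, and they determine the
solution. -/

/-- Modulo `A + B` one has `B ≡ -A`, so a Bézout combination `A u + B v` becomes `(u - v) A`. -/
theorem exists_nat_dvd_sub_mul {A B : ℤ} (hA : 0 < A) (hB : 0 < B) (c : ℤ)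
    (hc : (Int.gcd A B : ℤ) ∣ c) : ∃ k : ℕ, (A + B) ∣ c - k * A := by
  obtain ⟨e, rfl⟩ := hc
  have hg := Int.gcd_eq_gcd_ab A B
  set u := Int.gcdA A B
  set v := Int.gcdB A B
  refine ⟨((e * (u - v)) % (A + B)).toNat, ?_⟩
  rw [Int.toNat_of_nonneg (Int.emod_nonneg _ (by omega)), hg]
  have h1 : (A + B) ∣ e * (u - v) - (e * (u - v)) % (A + B) := Int.dvd_self_sub_emod
  have h2 : (A * u + B * v) * e - (e * (u - v)) % (A + B) * A
      = (A + B) * (v * e) + (e * (u - v) - (e * (u - v)) % (A + B)) * A := by ring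
  rw [h2]
  exact dvd_add (dvd_mul_right _ _) (Dvd.dvd.mul_right h1 _)

/-- In a window of length `A + B` exactly one of the moves `+ A` and `- B` stays inside, and both
are the rotation by `A` modulo `A + B`. -/
theorem orbit_of_shift_closed {S : ℤ → Prop} {s A B : ℤ} (hA : 0 < A) (hB : 0 < B)
    (hup : ∀ x, s ≤ x → x + A < s + (A + B) → S x → S (x + A))
    (hdown : ∀ x, s ≤ x - B → x < s + (A + B) → S x → S (x - B))
    {x : ℤ} (hx : s ≤ x) (hx' : x < s + (A + B)) (hS : S x) (k : ℕ) :
    S (s + (x - s + k * A) % (A + B)) := by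
  induction k with
  | zero =>
    have : (x - s + ((0 : ℕ) : ℤ) * A) % (A + B) = x - s := by
      rw [Int.emod_eq_of_lt] <;> push_cast <;> linarith
    rw [this]
    simpa using hS
  | succ k ih =>
    set t := (x - s + k * A) % (A + B) with ht
    have t0 : 0 ≤ t := Int.emod_nonneg _ (by omega)
    have t1 : t < A + B := Int.emod_lt_of_pos _ (by omega)
    have hstep : (x - s + ((k + 1 : ℕ) : ℤ) * A) % (A + B) = (t + A) % (A + B) := by
      rw [ht, Int.emod_add_emod]
      congr 1
      push_cast
      ring
    rw [hstep]
    by_cases h : t + A < A + B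
    · rw [Int.emod_eq_of_lt (by omega) h]
      have := hup (s + t) (by omega) (by omega) ih
      rwa [add_assoc] at this
    · have h3 : (t + A) % (A + B) = t - B := by
        rw [← Int.sub_emod_right (t + A) (A + B), Int.emod_eq_of_lt] <;> omega
      rw [h3]
      have := hdown (s + t) (by omega) (by omega) ih
      rwa [add_sub_assoc] at this

theorem orbit_of_dvd {S : ℤ → Prop} {s A B : ℤ} (hA : 0 < A) (hB : 0 < B)
    (hup : ∀ x, s ≤ x → x + A < s + (A + B) → S x → S (x + A))
    (hdown : ∀ x, s ≤ x - B → x < s + (A + B) → S x → S (x - B))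
    {x y : ℤ} (hx : s ≤ x) (hx' : x < s + (A + B)) (hy : s ≤ y) (hy' : y < s + (A + B))
    (hd : (Int.gcd A B : ℤ) ∣ y - x) (hS : S x) : S y := by
  obtain ⟨k, hk⟩ := exists_nat_dvd_sub_mul hA hB _ hd
  have h := orbit_of_shift_closed hA hB hup hdown hx hx' hS k
  have : (x - s + k * A) % (A + B) = y - s := by
    have h1 : (y - s) % (A + B) = y - s := Int.emod_eq_of_lt (by omega) (by omega)
    rw [← h1]
    apply Int.emod_eq_emod_iff_emod_sub_eq_zero.mpr
    apply Int.emod_eq_zero_of_dvd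
    have h2 : x - s + k * A - (y - s) = -(y - x - k * A) := by ring
    rw [h2]
    exact hk.neg_right
  rw [this] at h
  simpa using h

/-- A set of integers in `[lo, hi]` closed under `+ A` and `- B` with `A + B ≤ hi - lo + 1` is
periodic with period `gcd A B`. -/
theorem iff_add_gcd_of_shift_closed {S : ℤ → Prop} {lo hi A B : ℤ} (hA : 0 < A) (hB : 0 < B)
    (hlen : A + B ≤ hi - lo + 1)
    (hup : ∀ x, lo ≤ x → x + A ≤ hi → S x → S (x + A))
    (hdown : ∀ x, lo ≤ x - B → x ≤ hi → S x → S (x - B))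
    {x : ℤ} (hx : lo ≤ x) (hx' : x + Int.gcd A B ≤ hi) : S x ↔ S (x + Int.gcd A B) := by
  have hgA : (Int.gcd A B : ℤ) ≤ A := Int.le_of_dvd hA (Int.gcd_dvd_left _ _)
  have hg0 : (0 : ℤ) ≤ Int.gcd A B := by positivity
  -- A window of length `A + B` inside `[lo, hi]` that contains both points.
  obtain ⟨s, hs1, hs2, hs3, hs4⟩ : ∃ s : ℤ, lo ≤ s ∧ s ≤ x ∧ x + Int.gcd A B < s + (A + B) ∧
      s + (A + B) ≤ hi + 1 := by
    by_cases h : x + Int.gcd A B < lo + (A + B)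
    · exact ⟨lo, by omega, by omega, by omega, by omega⟩
    · exact ⟨x + Int.gcd A B - (A + B) + 1, by omega, by omega, by omega, by omega⟩
  have u : ∀ x, s ≤ x → x + A < s + (A + B) → S x → S (x + A) :=
    fun x h1 h2 => hup x (by omega) (by omega)
  have v : ∀ x, s ≤ x - B → x < s + (A + B) → S x → S (x - B) :=
    fun x h1 h2 => hdown x (by omega) (by omega)
  constructor
  · exact orbit_of_dvd hA hB u v (by omega) (by omega) (by omega) (by omega) (by simp)
  · exact orbit_of_dvd hA hB u v (by omega) (by omega) (by omega) (by omega) (by simp)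

/-- `P` is a period of the predicate `S` on the interval `[lo, hi]`. -/
def IsPeriodOn (S : ℤ → Prop) (lo hi P : ℤ) : Prop :=
  ∀ x, lo ≤ x → x + P ≤ hi → (S x ↔ S (x + P))

theorem IsPeriodOn.iff_of_dvd {S : ℤ → Prop} {lo hi P : ℤ} (h : IsPeriodOn S lo hi P) (hP : 0 < P)
    {x y : ℤ} (hx : lo ≤ x) (hxy : x ≤ y) (hy : y ≤ hi) (hd : P ∣ y - x) : S x ↔ S y := by
  obtain ⟨e, he⟩ := hd
  have he0 : 0 ≤ e := by
    by_contra hneg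
    nlinarith
  obtain ⟨k, rfl⟩ := Int.eq_ofNat_of_zero_le he0
  clear he0
  obtain rfl : y = x + P * k := by omega
  clear he
  induction k with
  | zero => simp
  | succ k ih =>
    have e1 : x + P * ((k + 1 : ℕ) : ℤ) = x + P * k + P := by push_cast; ring
    have hk : 0 ≤ P * (k : ℤ) := by positivity
    rw [e1] at hy ⊢
    exact (ih (by omega) (by omega)).trans (h _ (by omega) hy)

/-! ### Colourings without monochromatic solutions -/

/-- No `z ∈ C` has a solution `x + y = q z` with `x ≠ y`, `x, y ≥ lo` and `x`, `y` of the colour of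
`z`, where the colours of `x`, `y` are given by `χ` and that of `z` by `ζ`. -/
def Avoids (χ ζ : ℤ → Bool) (q : ℤ → ℤ) (lo : ℤ) (C : Set ℤ) : Prop :=
  ∀ z ∈ C, ∀ x y, lo ≤ x → lo ≤ y → x ≠ y → x + y = q z → ¬ (χ x = ζ z ∧ χ y = ζ z)

/-- The partner `q r - x` cannot have the colour of `r`, so it has that of `b`; as `x' + (q r - x) =
q b`, the point `x'` cannot have the colour of `b`. The two strict inequalities keep the summands
distinct. -/
theorem Avoids.shift {χ ζ : ℤ → Bool} {q : ℤ → ℤ} {lo : ℤ} {C : Set ℤ} (h : Avoids χ ζ q lo C)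
    {r b : ℤ} (hr : r ∈ C) (hb : b ∈ C) (hrb : ζ r ≠ ζ b) {x x' : ℤ} (hx : lo ≤ x) (hx' : lo ≤ x')
    (hxx : x' = x + (q b - q r)) (h1 : 2 * x < q r) (h2 : 2 * x' < q b) (hc : χ x = ζ r) :
    χ x' = ζ r := by
  have a1 := h r hr x (q r - x) hx (by omega) (by omega) (by omega)
  have a2 := h b hb x' (q r - x) hx' (by omega) (by omega) (by omega)
  revert a1 a2 hrb hc
  cases χ x <;> cases χ x' <;> cases χ (q r - x) <;> cases ζ r <;> cases ζ b <;> simp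

/-- If the clean elements `a < b < c` have alternating colours and are suitably spaced, then the
colouring is periodic with a bounded period, which is impossible. -/
theorem Avoids.no_alternation {χ ζ : ℤ → Bool} {q : ℤ → ℤ} {lo : ℤ} {C : Set ℤ}
    (h : Avoids χ ζ q lo C) {a b c Q R : ℤ} (ha : a ∈ C) (hb : b ∈ C) (hc : c ∈ C)
    (hab : ζ a ≠ ζ b) (hac : ζ a = ζ c)
    (hmin : ∀ z ∈ C, q a ≤ q z) (hmax : ∀ z ∈ C, q z ≤ q a + R)
    (hP : ∀ P : ℤ, 0 < P → (∀ z ∈ C, P ∣ q z - q a) → P ≤ Q ∧ ∃ s, P ∣ 2 * s - q a)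
    (hba : q a + 4 * Q + 8 ≤ q b) (hcb : q b - q a + 4 * Q + 8 ≤ q c - q b) (hQ : 0 ≤ Q)
    (hlo : 4 * R + 2 * lo + 4 * Q + 8 ≤ q a) : False := by
  set hi : ℤ := (q a - 1) / 2 with hhi
  have hhi1 : 2 * hi < q a := by omega
  have hhi2 : q a ≤ 2 * hi + 2 := by omega
  have hbR := hmax b hb
  have hcR := hmax c hc
  set S : ℤ → Prop := fun x => χ x = ζ a with hS
  have shift : ∀ z ∈ C, ∀ w ∈ C, ζ z = ζ a → ζ w ≠ ζ a → ∀ x, lo ≤ x → x ≤ hi →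
      lo ≤ x + (q w - q z) → x + (q w - q z) ≤ hi → S x → S (x + (q w - q z)) := by
    intro z hz w hw hza hwa x hx1 hx2 hx3 hx4 hx5
    have := hmin z hz
    have := hmin w hw
    have := h.shift hz hw (by rw [hza]; exact hwa.symm) hx1 hx3 rfl (by omega) (by omega)
      (by rw [hza]; exact hx5)
    rw [hza] at this
    exact this
  have combine : ∀ A B : ℤ, 0 < A → 0 < B → A ≤ R → B ≤ R →
      (∀ x, lo ≤ x → x + A ≤ hi → S x → S (x + A)) →
      (∀ x, lo ≤ x - B → x ≤ hi → S x → S (x - B)) → IsPeriodOn S lo hi (Int.gcd A B) := by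
    intro A B hA hB hAR hBR h1 h2 x hx hx'
    exact iff_add_gcd_of_shift_closed hA hB (by omega) h1 h2 hx hx'
  -- Passing from `a` to `b` shifts the class up, passing from `c` to `b` shifts it down.
  have hex : ∃ P : ℕ, 0 < P ∧ (P : ℤ) ≤ R ∧ IsPeriodOn S lo hi P := by
    refine ⟨Int.gcd (q b - q a) (q c - q b), ?_, ?_, ?_⟩
    · exact Int.gcd_pos_of_ne_zero_left _ (by omega)
    · exact (Int.le_of_dvd (by omega) (Int.gcd_dvd_left _ _)).trans (by omega)
    · refine combine _ _ (by omega) (by omega) (by omega) (by omega) ?_ ?_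
      · intro x h1 h2 h3
        exact shift a ha b hb rfl hab.symm x h1 (by omega) (by omega) h2 h3
      · intro x h1 h2 h3
        have := shift c hc b hb hac.symm hab.symm x (by omega) h2 (by omega) (by omega) h3
        rwa [show x + (q b - q c) = x - (q c - q b) by ring] at this
  classical
  obtain ⟨hP0, hPR, hPer⟩ := Nat.find_spec hex
  have hPmin := fun {m : ℕ} => Nat.find_min' hex (m := m)
  generalize Nat.find hex = P at hP0 hPR hPer hPmin
  have hP0' : (0 : ℤ) < P := by exact_mod_cast hP0
  -- `P` is the least period, so a period `gcd D P` cannot be a proper divisor of it.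
  have dvd_of_gcd : ∀ D : ℤ, D ≠ 0 → IsPeriodOn S lo hi (Int.gcd D P) → (P : ℤ) ∣ D := by
    intro D hD hper
    have hpos : 0 < Int.gcd D P := Int.gcd_pos_of_ne_zero_left _ hD
    have hle : (Int.gcd D P : ℤ) ≤ P := Int.le_of_dvd hP0' (Int.gcd_dvd_right _ _)
    have := hPmin ⟨hpos, by omega, hper⟩
    have : (Int.gcd D P : ℤ) = P := by omega
    rw [← this]
    exact Int.gcd_dvd_left _ _
  have dvd_pair : ∀ z ∈ C, ∀ w ∈ C, ζ z = ζ a → ζ w ≠ ζ a → (P : ℤ) ∣ q w - q z := by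
    intro z hz w hw hza hwa
    have := hmin z hz
    have := hmin w hw
    have := hmax z hz
    have := hmax w hw
    rcases lt_trichotomy (q w - q z) 0 with hD | hD | hD
    · rw [← Int.neg_neg (q w - q z)]
      refine (dvd_of_gcd (-(q w - q z)) (by omega) ?_).neg_right
      rw [Int.gcd_comm]
      refine combine P _ hP0' (by omega) hPR (by omega) ?_ ?_
      · intro x h1 h2 h3
        exact (hPer x h1 h2).1 h3
      · intro x h1 h2 h3
        have := shift z hz w hw hza hwa x (by omega) h2 (by omega) (by omega) h3
        rwa [show x + (q w - q z) = x - -(q w - q z) by ring] at this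
    · rw [hD]
      exact dvd_zero _
    · refine dvd_of_gcd _ (by omega) (combine _ P hD hP0' (by omega) hPR ?_ ?_)
      · intro x h1 h2 h3
        exact shift z hz w hw hza hwa x h1 (by omega) (by omega) h2 h3
      · intro x h1 h2 h3
        have := hPer (x - P) h1 (by omega)
        rw [sub_add_cancel] at this
        exact this.2 h3
  have dvd_all : ∀ z ∈ C, (P : ℤ) ∣ q z - q a := by
    intro z hz
    by_cases hza : ζ z = ζ a
    · have h1 := dvd_pair z hz b hb hza hab.symm
      have h2 := dvd_pair a ha b hb rfl hab.symm
      have := dvd_sub h2 h1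
      rwa [show q b - q a - (q b - q z) = q z - q a by ring] at this
    · exact dvd_pair a ha z hz rfl hza
  obtain ⟨hPQ, s, hs⟩ := hP P hP0' dvd_all
  -- Take `x ≡ s` in `[t/2 - P, t/2)`; then `t - x ≡ q a - s ≡ s` as well.
  have hpair : ∀ t : ℤ, (P : ℤ) ∣ t - q a → 2 * lo + 4 * Q + 4 ≤ t → t + 4 * Q + 6 ≤ q a →
      ∃ x x', lo ≤ x ∧ x < x' ∧ x' ≤ hi ∧ x + x' = t ∧ (P : ℤ) ∣ x' - x ∧ (P : ℤ) ∣ x - s := by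
    intro t ht h1 h2
    have m0 := Int.emod_nonneg (s - (t / 2 - P)) hP0'.ne'
    have m1 := Int.emod_lt_of_pos (s - (t / 2 - P)) hP0'
    set e := (s - (t / 2 - P)) % P with he
    have d1 : (P : ℤ) ∣ t / 2 - P + e - s := by
      have : (P : ℤ) ∣ (s - (t / 2 - P)) - e := Int.dvd_self_sub_emod
      have := this.neg_right
      rwa [show -(s - (t / 2 - P) - e) = t / 2 - P + e - s by ring] at this
    refine ⟨t / 2 - P + e, t - (t / 2 - P + e), by omega, by omega, by omega, by ring, ?_, d1⟩
    have e1 : t - (t / 2 - ↑P + e) - (t / 2 - ↑P + e)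
        = (t - q a) - (2 * s - q a) - 2 * (t / 2 - P + e - s) := by ring
    rw [e1]
    exact dvd_sub (dvd_sub ht hs) (d1.mul_left 2)
  have hbd := dvd_all b hb
  have hcd := dvd_all c hc
  -- With this sum, shifting `x` by `q b - q a` gives total `q a`. For the second pair, with sum `2
  -- q b - q c`, the complements to `q b` have total `q c`.
  obtain ⟨x, x', hx1, hx2, hx3, hx4, hx5, hx6⟩ := hpair (2 * q a - q b)
    (by rw [show 2 * q a - q b - q a = -(q b - q a) by ring]; exact hbd.neg_right)
    (by omega) (by omega)
  obtain ⟨y, y', hy1, hy2, hy3, hy4, hy5, hy6⟩ := hpair (2 * q b - q c)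
    (by rw [show 2 * q b - q c - q a = 2 * (q b - q a) - (q c - q a) by ring]
        exact dvd_sub (hbd.mul_left 2) hcd)
    (by omega) (by omega)
  have hxx : S x ↔ S x' := hPer.iff_of_dvd hP0' hx1 hx2.le hx3 hx5
  have hyy : S y ↔ S y' := hPer.iff_of_dvd hP0' hy1 hy2.le hy3 hy5
  have hxy : S x ↔ S y := by
    have d : (P : ℤ) ∣ x - y := by
      have := dvd_sub hx6 hy6
      rwa [show x - s - (y - s) = x - y by ring] at this
    rcases le_total x y with hle | hle
    · exact hPer.iff_of_dvd hP0' hx1 hle (by omega) (by rw [← neg_sub]; exact d.neg_right)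
    · exact (hPer.iff_of_dvd hP0' hy1 hle (by omega) d).symm
  -- All four points share a colour: if it is that of `a`, the first pair contradicts `a`; otherwise
  -- the complements of the second pair have the colour of `c` and contradict `c`.
  by_cases hSx : S x
  · have h1 := h.shift ha hb hab hx1 (x' := x + (q b - q a)) (by omega) rfl (by omega) (by omega)
      hSx
    exact h a ha (x + (q b - q a)) x' (by omega) (by omega) (by omega) (by omega)
      ⟨h1, hxx.1 hSx⟩
  · have hy : χ y = ζ b := by
      have : χ y ≠ ζ a := fun hh => hSx (hxy.2 hh)
      revert this hab
      cases χ y <;> cases ζ a <;> cases ζ b <;> simp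
    have hy' : χ y' = ζ b := by
      have : χ y' ≠ ζ a := fun hh => hSx (hxy.2 (hyy.2 hh))
      revert this hab
      cases χ y' <;> cases ζ a <;> cases ζ b <;> simp
    have k1 := h b hb y (q b - y) hy1 (by omega) (by omega) (by omega)
    have k2 := h b hb y' (q b - y') (by omega) (by omega) (by omega) (by omega)
    refine h c hc (q b - y) (q b - y') (by omega) (by omega) (by omega) (by omega) ?_
    rw [← hac]
    revert k1 k2 hy hy' hab
    cases χ y <;> cases χ y' <;> cases ζ a <;> cases ζ b <;> cases χ (q b - y) <;>
      cases χ (q b - y') <;> simp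

/-! ### Approximation by elements of a submonoid -/

/-- Every integer from `Y₀` on is approximated from below by an element of `M` with error less
than `v`. -/
def Approximates (M : AddSubmonoid ℤ) (v Y₀ : ℤ) : Prop :=
  ∀ Y, Y₀ ≤ Y → ∃ a ∈ M, a ≤ Y ∧ Y < a + v

theorem approximates_of_mem {M : AddSubmonoid ℤ} {D : ℤ} (hD : D ∈ M) (h0 : 0 < D) :
    Approximates M D 0 := by
  intro Y hY
  refine ⟨D * (Y / D), ?_, Int.mul_ediv_self_le h0.ne', Int.lt_mul_ediv_self_add h0⟩
  have : 0 ≤ Y / D := Int.ediv_nonneg hY h0.le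
  obtain ⟨k, hk⟩ := Int.eq_ofNat_of_zero_le this
  rw [hk, mul_comm, ← nsmul_eq_mul]
  exact M.nsmul_mem hD k

/-- Keep `k` copies of `u` in reserve. Replacing `t ≤ k` of them by `u + w` raises the sum by `t w`,
which brings an error below `v` under `w`. -/
theorem Approximates.refine {M : AddSubmonoid ℤ} {v Y₀ : ℤ} (h : Approximates M v Y₀) {u w : ℤ}
    (hu : u ∈ M) (huw : u + w ∈ M) (hw : 0 < w) {k : ℕ} (hk : v ≤ k * w) :
    Approximates M w (Y₀ + k * u) := by
  intro Y hY
  obtain ⟨a, ha, h1, h2⟩ := h (Y - k * u) (by linarith)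
  have t0 : 0 ≤ (Y - k * u - a) / w := Int.ediv_nonneg (by linarith) hw.le
  have t1 : (Y - k * u - a) / w < k := Int.ediv_lt_of_lt_mul hw (by linarith)
  have t2 := Int.mul_ediv_self_le (x := Y - k * u - a) hw.ne'
  have t3 := Int.lt_mul_ediv_self_add (x := Y - k * u - a) hw
  generalize (Y - k * u - a) / w = t at *
  obtain ⟨t, rfl⟩ := Int.eq_ofNat_of_zero_le t0
  obtain ⟨r, rfl⟩ : ∃ r, k = t + r := Nat.exists_eq_add_of_le (by omega)
  refine ⟨a + (r • u + t • (u + w)), M.add_mem ha (M.add_mem (M.nsmul_mem hu _)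
    (M.nsmul_mem huw _)), ?_, ?_⟩
  · simp only [nsmul_eq_mul]
    push_cast at *
    linarith
  · simp only [nsmul_eq_mul]
    push_cast at *
    linarith

theorem Approximates.mono {M : AddSubmonoid ℤ} {v Y₀ Y₁ : ℤ} (h : Approximates M v Y₀)
    (hY : Y₀ ≤ Y₁) : Approximates M v Y₁ := fun Y hY' => h Y (hY.trans hY')

/-- Iterated refinement along the scales `2 ^ (d * J), …, 2 ^ d, 1`. -/
theorem Approximates.refine_scales {M : AddSubmonoid ℤ} {v Q U : ℤ} {d J k : ℕ}
    (h : Approximates M v 0) (hQ : 0 < Q) (hk : v ≤ k * (Q * 2 ^ (d * J)))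
    (hsc : ∀ j ≤ J, ∃ u ∈ M, u ≤ U ∧ u + Q * 2 ^ (d * j) ∈ M) :
    Approximates M Q ((k + 2 ^ d * J) * U) := by
  have key : ∀ i ≤ J, Approximates M (Q * 2 ^ (d * (J - i))) ((k + 2 ^ d * i) * U) := by
    intro i
    induction i with
    | zero =>
      intro _
      obtain ⟨u, hu, huU, huw⟩ := hsc J le_rfl
      refine (h.refine hu huw (by positivity) hk).mono ?_
      push_cast
      linarith [mul_le_mul_of_nonneg_left huU (Nat.cast_nonneg (α := ℤ) k)]
    | succ i ih =>
      intro hi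
      obtain ⟨u, hu, huU, huw⟩ := hsc (J - (i + 1)) (by omega)
      refine ((ih (by omega)).refine hu huw (by positivity) (k := 2 ^ d) ?_).mono ?_
      · have : J - i = J - (i + 1) + 1 := by omega
        rw [this, mul_add, pow_add]
        push_cast
        apply le_of_eq
        ring
      · push_cast
        linarith [mul_le_mul_of_nonneg_left huU (by positivity : (0 : ℤ) ≤ 2 ^ d)]
  simpa using key J le_rfl

/-! ### Finite differences -/

open Polynomial in
theorem sum_choose_eval_eq (p : ℤ[X]) (c : ℤ) {h : ℤ} (hh : h ≠ 0) :
    ∑ k ∈ Finset.range (p.natDegree + 1), (-1 : ℤ) ^ (p.natDegree - k) *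
      p.natDegree.choose k * p.eval (c + k * h)
      = p.natDegree.factorial * p.leadingCoeff * h ^ p.natDegree := by
  set P := p.comp (C h * X + C c) with hP
  have hd1 : (C h * X + C c).natDegree = 1 := natDegree_linear hh
  have hdeg : P.natDegree = p.natDegree := by rw [hP, natDegree_comp, hd1, mul_one]
  have hlead : P.leadingCoeff = p.leadingCoeff * h ^ p.natDegree := by
    rw [hP, leadingCoeff_comp (by rw [hd1]; norm_num), leadingCoeff_linear hh]
  have h1 := congrFun (Polynomial.fwdDiff_iter_degree_eq_factorial P) 0
  rw [fwdDiff_iter_eq_sum_shift, hdeg, hlead] at h1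
  simp only [Pi.smul_apply, smul_eq_mul, Pi.natCast_apply] at h1
  rw [show (p.natDegree.factorial : ℤ) * p.leadingCoeff * h ^ p.natDegree
    = p.leadingCoeff * h ^ p.natDegree * p.natDegree.factorial by ring, ← h1]
  refine Finset.sum_congr rfl fun k _ => ?_
  congr 1
  simp only [hP, eval_comp, eval_add, eval_mul, eval_C, eval_X]
  congr 1
  simp
  ring

open Polynomial in
/-- The two sides of the finite difference identity, as elements of a submonoid that contains
`p (c + k h) - ρ` for `k ≤ deg p`. -/
theorem exists_mem_add_factorial_mem (p : ℤ[X]) (hd : 1 ≤ p.natDegree) (c ρ D : ℤ) {h : ℤ}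
    (hh : h ≠ 0)    (M : AddSubmonoid ℤ) (hM : ∀ k ≤ p.natDegree, p.eval (c + k * h) - ρ ∈ M)
    (hD : ∀ k ≤ p.natDegree, p.eval (c + k * h) - ρ ≤ D) (hD0 : 0 ≤ D) :
    ∃ u ∈ M, u ≤ 2 ^ p.natDegree * D ∧
      u + p.natDegree.factorial * p.leadingCoeff * h ^ p.natDegree ∈ M := by
  set d := p.natDegree with hdd
  set f : ℕ → ℤ := fun k => p.eval (c + k * h) - ρ with hf
  set s := Finset.range (d + 1) with hs
  -- The negative terms of the alternating sum make up `u`, the positive ones the other side. The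
  -- constant `ρ` cancels since the alternating binomial sum vanishes for `d ≥ 1`.
  set O := s.filter (fun k => ¬ Even (d - k)) with hO
  set E := s.filter (fun k => Even (d - k)) with hE
  have hmem : ∀ t ⊆ s, ∑ k ∈ t, (d.choose k : ℤ) * f k ∈ M := by
    intro t ht
    refine M.sum_mem fun k hk => ?_
    rw [← nsmul_eq_mul]
    exact M.nsmul_mem (hM k (by have := ht hk; simp [hs] at this; omega)) _
  refine ⟨∑ k ∈ O, (d.choose k : ℤ) * f k, hmem _ (Finset.filter_subset _ _), ?_, ?_⟩
  · calc ∑ k ∈ O, (d.choose k : ℤ) * f k ≤ ∑ k ∈ O, (d.choose k : ℤ) * D := by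
          refine Finset.sum_le_sum fun k hk => ?_
          have : k ≤ d := by simp [hO, hs] at hk; omega
          exact mul_le_mul_of_nonneg_left (hD k this) (by positivity)
      _ ≤ ∑ k ∈ s, (d.choose k : ℤ) * D :=
          Finset.sum_le_sum_of_subset_of_nonneg (Finset.filter_subset _ _)
            fun k _ _ => by positivity
      _ = 2 ^ d * D := by
          rw [← Finset.sum_mul]
          congr 1
          exact_mod_cast Nat.sum_range_choose d
  · have key : ∑ k ∈ O, (d.choose k : ℤ) * f k + d.factorial * p.leadingCoeff * h ^ d
        = ∑ k ∈ E, (d.choose k : ℤ) * f k := by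
      have h1 : ∑ k ∈ s, (-1 : ℤ) ^ (d - k) * d.choose k * f k
          = d.factorial * p.leadingCoeff * h ^ d := by
        rw [← sum_choose_eval_eq p c hh, ← hdd]
        have h0 : ∑ k ∈ s, (-1 : ℤ) ^ (d - k) * d.choose k * ρ = 0 := by
          rw [← Finset.sum_mul]
          have := (add_pow (1 : ℤ) (-1) d).symm
          rw [add_neg_cancel, zero_pow (by omega)] at this
          rw [show ∑ k ∈ s, (-1 : ℤ) ^ (d - k) * (d.choose k : ℤ) = 0 by
            rw [← this]; exact Finset.sum_congr rfl fun k _ => by ring, zero_mul]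
        rw [← sub_zero (∑ k ∈ s, _ * p.eval _), ← h0, ← Finset.sum_sub_distrib]
        exact Finset.sum_congr rfl fun k _ => by simp only [hf]; ring
      rw [← h1, ← Finset.sum_filter_add_sum_filter_not s (fun k => Even (d - k))]
      have h2 : ∑ k ∈ E, (-1 : ℤ) ^ (d - k) * d.choose k * f k = ∑ k ∈ E, (d.choose k : ℤ) * f k := by
        refine Finset.sum_congr rfl fun k hk => ?_
        rw [(Finset.mem_filter.1 hk).2.neg_one_pow, one_mul]
      have h3 : ∑ k ∈ O, (-1 : ℤ) ^ (d - k) * d.choose k * f k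
          = -∑ k ∈ O, (d.choose k : ℤ) * f k := by
        rw [← Finset.sum_neg_distrib]
        refine Finset.sum_congr rfl fun k hk => ?_
        rw [(Nat.not_even_iff_odd.1 (Finset.mem_filter.1 hk).2).neg_one_pow]
        ring
      rw [h2, h3]
      ring
    rw [key]
    exact hmem _ (Finset.filter_subset _ _)

/-! ### A single change of colour -/

/-- `z` has no solution `x + y = q z` with `x`, `y`, `z` positive, distinct and of one colour. -/
def IsClean (χ : ℤ → Bool) (q : ℤ → ℤ) (z : ℤ) : Prop :=
  ∀ x y, 1 ≤ x → 1 ≤ y → x ≠ y → x ≠ z → y ≠ z → x + y = q z → ¬ (χ x = χ z ∧ χ y = χ z)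

/-- The colour of `r` propagates along the submonoid generated by the differences `q b - q r`. -/
theorem color_of_mem_closure {χ : ℤ → Bool} {q : ℤ → ℤ} {r lo : ℤ} {B : Set ℤ}
    (hr : IsClean χ q r) (hB : ∀ b ∈ B, IsClean χ q b ∧ χ b ≠ χ r ∧ b < lo ∧ lo ≤ q b - q r)
    (hrlo : r < lo) (hlo : 2 * lo ≤ q r) (h1lo : 1 ≤ lo) {x : ℤ} (hx : 1 ≤ x) (hxr : x < r)
    (hxc : χ x = χ r)
    {a : ℤ} (ha : a ∈ AddSubmonoid.closure ((fun b => q b - q r) '' B))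
    (hxa : 2 * (x + a) < q r) : χ (x + a) = χ r := by
  -- The dichotomy on `a` keeps `x + a` different from `r`: it is below `r` for `a = 0` and above
  -- `lo > r` otherwise.
  suffices H : (a = 0 ∨ lo ≤ a) ∧ (2 * (x + a) < q r → χ (x + a) = χ r) from H.2 hxa
  clear hxa
  induction ha using AddSubmonoid.closure_induction_right with
  | zero => exact ⟨Or.inl rfl, fun _ => by simpa using hxc⟩
  | add_right a ha y hy ih =>
    obtain ⟨b, hb, rfl⟩ := hy
    obtain ⟨hb1, hb2, hb3, hb4⟩ := hB b hb
    dsimp only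
    obtain ⟨ih1, ih2⟩ := ih
    refine ⟨Or.inr (by omega), fun hlt => ?_⟩
    have c1 := ih2 (by omega)
    have k1 := hr (x + a) (q r - (x + a)) (by omega) (by omega) (by omega) (by omega) (by omega)
      (by omega)
    have k2 := hb1 (x + (a + (q b - q r))) (q r - (x + a)) (by omega) (by omega) (by omega)
      (by omega) (by omega) (by omega)
    revert c1 k1 k2 hb2
    cases χ (x + a) <;> cases χ (x + (a + (q b - q r))) <;> cases χ (q r - (x + a)) <;>
      cases χ r <;> cases χ b <;> simp

/-- Write `q w = (x₀ + a') + (x₁ + a)` with `a`, `a'` in the submonoid and `x₁` in the run of length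
`Q`, whose length absorbs the approximation error. Both summands inherit the colour of the run,
which is that of `w`. -/
theorem no_single_change {χ : ℤ → Bool} {q : ℤ → ℤ} {r lo : ℤ} {B : Set ℤ}
    (hr : IsClean χ q r) (hB : ∀ b ∈ B, IsClean χ q b ∧ χ b ≠ χ r ∧ b < lo ∧ lo ≤ q b - q r)
    (hrlo : r < lo) (hlo : 2 * lo ≤ q r) {x₀ Q Y₀ : ℤ} (hx₀ : 1 ≤ x₀) (hQ : 0 < Q)
    (hrun : ∀ x, x₀ ≤ x → x < x₀ + Q → χ x = χ r) (hrun' : x₀ + Q ≤ r)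
    (happ : Approximates (AddSubmonoid.closure ((fun b => q b - q r) '' B)) Q Y₀)
    {w : ℤ} (hw : IsClean χ q w) (hwr : χ w = χ r) (hwlo : w < lo)
    (hY : 2 * Y₀ + 2 * lo + 4 * Q + 4 * r + 8 ≤ q w) (hY₀ : 0 ≤ Y₀)
    (hqw : q w + 4 * Q + 2 * r + 10 ≤ q r) : False := by
  obtain ⟨a', ha', h1, h2⟩ := happ (q w / 2 - x₀ - 1) (by omega)
  obtain ⟨a, ha, h3, h4⟩ := happ (q w - (x₀ + a') - x₀) (by omega)
  have c1 := color_of_mem_closure hr hB hrlo hlo (by omega) hx₀ (by omega)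
    (hrun x₀ le_rfl (by omega)) ha' (by omega)
  have c2 := color_of_mem_closure hr hB hrlo hlo (by omega) (x := q w - (x₀ + a') - a) (by omega)
    (by omega) (hrun _ (by omega) (by omega)) ha (by omega)
  rw [sub_add_cancel] at c2
  exact hw (x₀ + a') (q w - (x₀ + a')) (by omega) (by omega) (by omega) (by omega) (by omega)
    (by omega) ⟨c1.trans hwr.symm, c2.trans hwr.symm⟩

/-! ### Growth of polynomials -/

section Growth

open Polynomial

theorem exists_forall_pow_le_two_mul_aeval (f : ℤ[X]) (k : ℕ) (hdeg : f.natDegree ≤ k)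
    (hc : 1 ≤ f.coeff k) : ∃ S : ℝ, 1 ≤ S ∧ ∀ z : ℝ, S ≤ z → z ^ k ≤ 2 * aeval z f := by
  set B : ℝ := ∑ i ∈ Finset.range k, |(f.coeff i : ℝ)| with hB
  have hB0 : 0 ≤ B := Finset.sum_nonneg fun _ _ => abs_nonneg _
  refine ⟨2 * B + 1, by linarith, fun z hz => ?_⟩
  have hz1 : 1 ≤ z := by linarith
  have hsum : aeval z f = ∑ i ∈ Finset.range k, (f.coeff i : ℝ) * z ^ i + f.coeff k * z ^ k := by
    rw [aeval_eq_sum_range' (Nat.lt_succ_of_le hdeg), Finset.sum_range_succ]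
    simp
  have hlow : -(B * z ^ k) ≤ z * ∑ i ∈ Finset.range k, (f.coeff i : ℝ) * z ^ i := by
    rw [hB, Finset.sum_mul, ← Finset.sum_neg_distrib, Finset.mul_sum]
    refine Finset.sum_le_sum fun i hi => ?_
    have h1 : z ^ (i + 1) ≤ z ^ k := pow_le_pow_right₀ hz1 (by simpa using hi)
    have h2 : 0 ≤ z ^ (i + 1) := by positivity
    have h3 := neg_abs_le (f.coeff i : ℝ)
    calc -(|(f.coeff i : ℝ)| * z ^ k) ≤ -|(f.coeff i : ℝ)| * z ^ (i + 1) := by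
          nlinarith [abs_nonneg (f.coeff i : ℝ)]
      _ ≤ (f.coeff i : ℝ) * z ^ (i + 1) := mul_le_mul_of_nonneg_right h3 h2
      _ = z * ((f.coeff i : ℝ) * z ^ i) := by ring
  have hc' : (1 : ℝ) ≤ f.coeff k := by exact_mod_cast hc
  have hzk : 0 < z ^ k := by positivity
  have : z * z ^ k ≤ z * (2 * aeval z f) := by
    rw [hsum]
    nlinarith [mul_le_mul_of_nonneg_right hc' (by positivity : 0 ≤ z * z ^ k),
      mul_le_mul_of_nonneg_right hz hzk.le]
  exact le_of_mul_le_mul_left this (by linarith)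

theorem exists_forall_aeval_le_mul_pow (f : ℤ[X]) (k : ℕ) (hdeg : f.natDegree ≤ k) :
    ∃ K : ℤ, 1 ≤ K ∧ ∀ z : ℤ, 1 ≤ z → f.eval z ≤ K * z ^ k := by
  refine ⟨∑ i ∈ Finset.range (k + 1), |f.coeff i| + 1, ?_, fun z hz => ?_⟩
  · have : 0 ≤ ∑ i ∈ Finset.range (k + 1), |f.coeff i| := Finset.sum_nonneg fun _ _ => abs_nonneg _
    linarith
  · rw [eval_eq_sum_range' (Nat.lt_succ_of_le hdeg), add_mul, Finset.sum_mul]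
    have : 0 ≤ 1 * z ^ k := by positivity
    refine (Finset.sum_le_sum fun i hi => ?_).trans (le_add_of_nonneg_right this)
    have hz0 : (0 : ℤ) ≤ z ^ i := by positivity
    calc f.coeff i * z ^ i ≤ |f.coeff i| * z ^ i := mul_le_mul_of_nonneg_right (le_abs_self _) hz0
      _ ≤ |f.coeff i| * z ^ k := by
        refine mul_le_mul_of_nonneg_left (pow_le_pow_right₀ hz ?_) (abs_nonneg _)
        simp at hi
        omega

theorem aeval_intCast_eq_intCast_eval (f : ℤ[X]) (z : ℤ) :
    aeval (z : ℝ) f = ((f.eval z : ℤ) : ℝ) := by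
  rw [← eq_intCast (algebraMap ℤ ℝ) z, aeval_algebraMap_apply, coe_aeval_eq_eval]
  simp

theorem exists_forall_pow_le_two_mul_eval (f : ℤ[X]) (k : ℕ) (hdeg : f.natDegree ≤ k)
    (hc : 1 ≤ f.coeff k) : ∃ S : ℤ, 1 ≤ S ∧ ∀ z : ℤ, S ≤ z → z ^ k ≤ 2 * f.eval z := by
  obtain ⟨S, hS, h⟩ := exists_forall_pow_le_two_mul_aeval f k hdeg hc
  refine ⟨⌈S⌉, by exact_mod_cast hS.trans (Int.le_ceil S), fun z hz => ?_⟩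
  have := h z (Int.ceil_le.1 hz)
  rw [aeval_intCast_eq_intCast_eval] at this
  exact_mod_cast this

/-- Where the second derivative is nonnegative, secant slopes lie between derivatives. -/
theorem exists_forall_secant_bounds (p : ℤ[X]) (hd : 2 ≤ p.natDegree) (hl : 0 < p.leadingCoeff) :
    ∃ S : ℤ, 1 ≤ S ∧ ∀ a b : ℤ, S ≤ a → a ≤ b →
      (b - a) * (derivative p).eval a ≤ p.eval b - p.eval a ∧
      p.eval b - p.eval a ≤ (b - a) * (derivative p).eval b := by
  set d := p.natDegree with hdd
  have hcoeff : 1 ≤ (derivative (derivative p)).coeff (d - 2) := by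
    rw [coeff_derivative, coeff_derivative, show d - 2 + 1 + 1 = d by omega]
    have : 1 ≤ p.coeff d := hl
    have h2 : (1 : ℤ) ≤ ((d - 2 : ℕ) : ℤ) + 1 := by omega
    have h3 : (1 : ℤ) ≤ ((d - 2 + 1 : ℕ) : ℤ) + 1 := by omega
    have := one_le_mul_of_one_le_of_one_le this h3
    exact one_le_mul_of_one_le_of_one_le this h2
  obtain ⟨S, hS, h⟩ := exists_forall_pow_le_two_mul_aeval (derivative (derivative p)) (d - 2)
    ((natDegree_derivative_le _).trans ((Nat.sub_le_sub_right (natDegree_derivative_le _) 1).trans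
      (by omega))) hcoeff
  have hev := aeval_intCast_eq_intCast_eval
  have hderiv : ∀ (f : ℤ[X]) (z : ℝ), deriv (fun x : ℝ => aeval x f) z = aeval z (derivative f) :=
    fun f z => by simp
  have hmono : MonotoneOn (fun x : ℝ => aeval x (derivative p)) (Set.Ici S) := by
    refine monotoneOn_of_deriv_nonneg (convex_Ici S) (by fun_prop)
      (Polynomial.differentiable_aeval _).differentiableOn fun x hx => ?_
    rw [hderiv]
    rw [interior_Ici] at hx
    have := h x (le_of_lt hx)
    have hx0 : 0 ≤ x := by linarith [Set.mem_Ioi.1 hx]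
    have : 0 ≤ x ^ (d - 2) := by positivity
    linarith
  refine ⟨⌈S⌉, by exact_mod_cast hS.trans (Int.le_ceil S), fun a b ha hab => ?_⟩
  rcases hab.eq_or_lt with rfl | hlt
  · simp
  have haS : S ≤ a := Int.ceil_le.1 ha
  have hlt' : (a : ℝ) < b := by exact_mod_cast hlt
  obtain ⟨c, hc, hcs⟩ := exists_deriv_eq_slope (fun x : ℝ => aeval x p) hlt' (by fun_prop)
    (Polynomial.differentiable_aeval _).differentiableOn
  rw [hderiv, hev, hev, eq_div_iff (by linarith)] at hcs
  have m1 := hmono (Set.mem_Ici.2 haS) (Set.mem_Ici.2 (haS.trans hc.1.le)) hc.1.le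
  have m2 := hmono (Set.mem_Ici.2 (haS.trans hc.1.le)) (Set.mem_Ici.2 (haS.trans hlt'.le)) hc.2.le
  simp only [hev] at m1 m2
  have hpos : (0 : ℝ) < b - a := by linarith
  constructor
  · have : ((b - a : ℤ) : ℝ) * ((derivative p).eval a : ℤ) ≤ ((p.eval b - p.eval a : ℤ) : ℝ) := by
      push_cast
      nlinarith
    exact_mod_cast this
  · have : ((p.eval b - p.eval a : ℤ) : ℝ) ≤ ((b - a : ℤ) : ℝ) * ((derivative p).eval b : ℤ) := by
      push_cast
      nlinarith
    exact_mod_cast this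

/-- Growth estimates for `p` of degree `d` from `z₀` on, with the constant `K`. -/
structure GrowthBounds (p : ℤ[X]) (d : ℕ) (z₀ K : ℤ) : Prop where
  one_le_start : 1 ≤ z₀
  one_le_const : 1 ≤ K
  pow_le : ∀ z, z₀ ≤ z → z ^ d ≤ 2 * p.eval z
  le_pow : ∀ z, 1 ≤ z → p.eval z ≤ K * z ^ d
  le_sub : ∀ a b, z₀ ≤ a → a ≤ b → (b - a) * a ^ (d - 1) ≤ 2 * (p.eval b - p.eval a)
  sub_le : ∀ a b, z₀ ≤ a → a ≤ b → p.eval b - p.eval a ≤ (b - a) * (K * b ^ (d - 1))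
  sub_add_le_sub : ∀ a b c, z₀ ≤ a → a ≤ b → b - a + 1 ≤ c - b →
    2 * (p.eval b - p.eval a) + b ^ (d - 1) ≤ 2 * (p.eval c - p.eval b)

theorem exists_growthBounds (p : ℤ[X]) (d : ℕ) (hd : 2 ≤ d) (hdeg : p.natDegree = d)
    (hl : 0 < p.leadingCoeff) : ∃ z₀ K, GrowthBounds p d z₀ K := by
  have hl' : 1 ≤ p.coeff d := by rw [← hdeg]; exact hl
  have hder : (derivative p).natDegree ≤ d - 1 := hdeg ▸ natDegree_derivative_le p
  have hdc : 1 ≤ (derivative p).coeff (d - 1) := by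
    rw [coeff_derivative, show d - 1 + 1 = d by omega]
    exact one_le_mul_of_one_le_of_one_le hl' (by omega)
  obtain ⟨S₁, -, hS₁⟩ := exists_forall_pow_le_two_mul_eval p d hdeg.le hl'
  obtain ⟨S₂, -, hS₂⟩ := exists_forall_pow_le_two_mul_eval (derivative p) (d - 1) hder hdc
  obtain ⟨S₃, hS₃1, hS₃⟩ := exists_forall_secant_bounds p (by omega) hl
  obtain ⟨K₁, hK₁, h₁⟩ := exists_forall_aeval_le_mul_pow p d hdeg.le
  obtain ⟨K₂, hK₂, h₂⟩ := exists_forall_aeval_le_mul_pow (derivative p) (d - 1) hder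
  have lo : ∀ a b, max S₁ (max S₂ S₃) ≤ a → a ≤ b →
      (b - a) * a ^ (d - 1) ≤ 2 * (p.eval b - p.eval a) := by
    intro a b ha hab
    have k1 := (hS₃ a b (by omega) hab).1
    have k2 := mul_le_mul_of_nonneg_left (hS₂ a (by omega)) (by omega : 0 ≤ b - a)
    linarith
  refine ⟨max S₁ (max S₂ S₃), max K₁ K₂, by omega, by omega, fun z hz => hS₁ z (by omega),
    fun z hz => (h₁ z hz).trans ?_, lo, fun a b ha hab => ?_, fun a b c ha hab hc => ?_⟩
  · exact mul_le_mul_of_nonneg_right (le_max_left _ _) (by positivity)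
  · refine (hS₃ a b (by omega) hab).2.trans (mul_le_mul_of_nonneg_left ?_ (by omega))
    refine (h₂ b (by omega)).trans (mul_le_mul_of_nonneg_right (le_max_right _ _) ?_)
    have : 0 ≤ b := by omega
    positivity
  · have k1 := (hS₃ a b (by omega) hab).2
    have k2 := (hS₃ b c (by omega) (by omega)).1
    have k3 := hS₂ b (by omega)
    have hb : 0 ≤ b := by omega
    have k4 : 0 ≤ b ^ (d - 1) := by positivity
    have k5 : 0 ≤ (c - b - (b - a) - 1) * (derivative p).eval b :=
      mul_nonneg (by omega) (by omega)
    nlinarith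

end Growth

/-! ### Degree at least two: changes of colour are impossible -/

theorem exists_notMem_of_injective (Z : Finset ℤ) {f : ℕ → ℤ} (hf : Function.Injective f) :
    ∃ k ≤ Z.card, f k ∉ Z := by
  by_contra! h
  have : (Finset.range (Z.card + 1)).image f ⊆ Z := by
    intro x hx
    obtain ⟨k, hk, rfl⟩ := Finset.mem_image.1 hx
    exact h k (by simpa [Nat.lt_succ_iff] using hk)
  have := Finset.card_le_card this
  rw [Finset.card_image_of_injective _ hf, Finset.card_range] at this
  omega

theorem exists_mem_Icc_notMem (Z : Finset ℤ) {G : ℤ} (hG : (Z.card : ℤ) ≤ G) (u : ℤ) :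
    ∃ c, u ≤ c ∧ c ≤ u + G ∧ c ∉ Z := by
  obtain ⟨k, hk, h⟩ := exists_notMem_of_injective Z (f := fun k : ℕ => u + k)
    (fun x y hxy => by simpa using hxy)
  exact ⟨u + k, by omega, by omega, h⟩

/-- An arithmetic progression of given length and step that avoids `Z`. -/
theorem exists_progression_notMem (Z : Finset ℤ) (u h : ℤ) (l : ℕ) :
    ∃ c, u ≤ c ∧ c ≤ u + (l + 1) * Z.card ∧ ∀ k : ℕ, k ≤ l → c + k * h ∉ Z := by
  set bad := (Finset.range (l + 1)).biUnion fun k => Z.image fun z => z - k * h with hbad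
  have hcard : bad.card ≤ (l + 1) * Z.card := by
    refine Finset.card_biUnion_le.trans ?_
    refine (Finset.sum_le_sum fun k _ => Finset.card_image_le).trans ?_
    simp
  obtain ⟨c, h1, h2, h3⟩ := exists_mem_Icc_notMem bad (G := (l + 1) * Z.card)
    (by exact_mod_cast hcard) u
  refine ⟨c, h1, h2, fun k hk hc => h3 ?_⟩
  rw [hbad, Finset.mem_biUnion]
  exact ⟨k, by simpa [Nat.lt_succ_iff] using hk, Finset.mem_image.2 ⟨_, hc, by ring⟩⟩

section HigherDegree

open Polynomial

/-- A modulus for which `p` is constant on the elements of a long interval outside a sparse set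
is bounded, and half of that constant exists. -/
theorem period_bound {p : ℤ[X]} (hd : 1 ≤ p.natDegree) (hl : 0 < p.leadingCoeff)
    (hpar : 2 ∣ p.eval 1 * p.eval 2) {Z : Finset ℤ} {a H R : ℤ}
    (hH : (p.natDegree.factorial * p.leadingCoeff + p.natDegree + 2) * (Z.card + 1) ≤ H)
    (hmax : ∀ z, a ≤ z → z ≤ a + H → p.eval z ≤ p.eval a + R) (hR : 0 ≤ R)
    {P : ℤ} (hP : 0 < P) (h : ∀ z, a ≤ z → z ≤ a + H → z ∉ Z → P ∣ p.eval z - p.eval a) :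
    P ≤ p.natDegree.factorial * p.leadingCoeff ∧ ∃ s, P ∣ 2 * s - p.eval a := by
  set d := p.natDegree with hdd
  set Q := (d.factorial : ℤ) * p.leadingCoeff with hQ
  have hQ0 : 0 < Q := by positivity
  -- Finite differences of step 1 along a progression avoiding `Z`, with the multiples of `P` as
  -- submonoid.
  have hdvd : P ∣ Q := by
    obtain ⟨c, hc1, hc2, hc3⟩ := exists_progression_notMem Z a 1 d
    have hin : ∀ k ≤ d, a ≤ c + (k : ℤ) * 1 ∧ c + (k : ℤ) * 1 ≤ a + H := by
      intro k hk
      constructor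
      · omega
      · have : (k : ℤ) ≤ d := by exact_mod_cast hk
        nlinarith [mul_nonneg hQ0.le (by positivity : (0 : ℤ) ≤ Z.card + 1)]
    obtain ⟨u, hu, -, huw⟩ := exists_mem_add_factorial_mem p hd c (p.eval a) R one_ne_zero
      (AddSubgroup.zmultiples P).toAddSubmonoid
      (fun k hk => Int.mem_zmultiples_iff.2 (h _ (hin k hk).1 (hin k hk).2 (hc3 k hk)))
      (fun k hk => by linarith [hmax _ (hin k hk).1 (hin k hk).2]) hR
    have e1 := Int.mem_zmultiples_iff.1 hu
    have e2 := Int.mem_zmultiples_iff.1 huw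
    have := (Int.dvd_add_right e1).1 e2
    simpa using this
  have hPQ : P ≤ Q := Int.le_of_dvd hQ0 hdvd
  refine ⟨hPQ, ?_⟩
  -- As `P ≤ Q`, the interval holds `|Z| + 1` members of every class modulo `P`, one of them outside
  -- `Z`; so `p` is constant modulo `P` on all integers.
  have hall : ∀ ρ : ℤ, P ∣ p.eval ρ - p.eval a := by
    intro ρ
    have m0 := Int.emod_nonneg (ρ - a) hP.ne'
    have m1 := Int.emod_lt_of_pos (ρ - a) hP
    obtain ⟨k, hk, hkZ⟩ := exists_notMem_of_injective Z
      (f := fun k : ℕ => a + (ρ - a) % P + P * k) (fun x y hxy => by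
        have : P * (x : ℤ) = P * y := by simpa using hxy
        exact_mod_cast mul_left_cancel₀ hP.ne' this)
    have hk' : (k : ℤ) ≤ Z.card := by exact_mod_cast hk
    have hk0 : (0 : ℤ) ≤ P * k := by positivity
    have hle : P * (k : ℤ) ≤ Q * Z.card :=
      mul_le_mul hPQ hk' (by positivity) hQ0.le
    have hdZ : 0 ≤ ((d : ℤ) + 2) * (Z.card + 1) := by positivity
    have h1 := h _ (by omega) (by linarith) hkZ
    have h2 : P ∣ ρ - (a + (ρ - a) % P + P * k) := by
      have : P ∣ (ρ - a) - (ρ - a) % P := Int.dvd_self_sub_emod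
      have := dvd_sub this (dvd_mul_right P (k : ℤ))
      rwa [show ρ - a - (ρ - a) % P - P * k = ρ - (a + (ρ - a) % P + P * k) by ring] at this
    have h3 := h2.trans (sub_dvd_eval_sub ρ (a + (ρ - a) % P + P * k) p)
    have := dvd_add h3 h1
    rwa [sub_add_sub_cancel] at this
  -- For even `P` the constant value is even because `p 1` or `p 2` is; for odd `P` the number 2 is
  -- invertible.
  rcases Int.even_or_odd P with hev | hodd
  · have h2P : (2 : ℤ) ∣ P := hev.two_dvd
    have d1 := h2P.trans (hall 1)
    have d2 := h2P.trans (hall 2)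
    have : (2 : ℤ) ∣ p.eval a := by
      rcases Int.prime_two.dvd_or_dvd hpar with h | h <;> omega
    obtain ⟨s, hs⟩ := this
    exact ⟨s, by rw [hs]; simp⟩
  · obtain ⟨t, ht⟩ := hodd
    refine ⟨p.eval a * (t + 1), p.eval a, ?_⟩
    rw [ht]
    ring

/-- The constant `d! a_d`. -/
noncomputable def topDiff (p : ℤ[X]) : ℤ := p.natDegree.factorial * p.leadingCoeff

theorem topDiff_pos {p : ℤ[X]} (hl : 0 < p.leadingCoeff) : 0 < topDiff p := by
  unfold topDiff
  positivity

/-- Convexity of `p` turns the spacing of `a`, `b`, `c` into the spacing of values that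
`Avoids.no_alternation` needs, and `period_bound` supplies its arithmetic input. -/
theorem no_alternation_of_clean {p : ℤ[X]} {d : ℕ} {z₀ K : ℤ} (hd : 2 ≤ d) (hdeg : p.natDegree = d)
    (hl : 0 < p.leadingCoeff) (hpar : 2 ∣ p.eval 1 * p.eval 2) (hg : GrowthBounds p d z₀ K)
    {χ : ℤ → Bool} {Z : Finset ℤ} {a b c H : ℤ}
    (hclean : ∀ z, a ≤ z → z ≤ a + H → z ∉ Z → IsClean χ p.eval z)
    (ha : a ∉ Z) (hb : b ∉ Z) (hc : c ∉ Z) (hab : a < b) (hbc : b - a + 1 ≤ c - b)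
    (hcH : c ≤ a + H) (hχab : χ a ≠ χ b) (hχac : χ a = χ c)
    (hH : (topDiff p + d + 2) * (Z.card + 1) ≤ H)
    (ha₀ : z₀ ≤ a) (haQ : 8 * topDiff p + 100 ≤ a) (hHa : 32 * K * 2 ^ d * H ≤ a) : False := by
  have hQ0 := topDiff_pos hl
  set Q := topDiff p with hQ
  have hK := hg.one_le_const
  have ha0 : 0 < a := by omega
  have hK0 : 0 < K := by omega
  have hH0 : 0 ≤ H := by omega
  have h2d : (1 : ℤ) ≤ 2 ^ d := one_le_pow₀ (by norm_num)
  have hHle : H ≤ a := by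
    have : (1 : ℤ) ≤ 32 * K * 2 ^ d := by nlinarith
    nlinarith
  have hpow : ∀ z, a ≤ z → a ≤ z ^ (d - 1) := fun z hz =>
    hz.trans (le_self_pow₀ (by omega) (by omega))
  have hba := hg.le_sub a b ha₀ hab.le
  have hba' : a ^ (d - 1) ≤ (b - a) * a ^ (d - 1) :=
    le_mul_of_one_le_left (by positivity) (by omega)
  have := hpow a le_rfl
  have hcb := hg.sub_add_le_sub a b c ha₀ hab.le hbc
  have := hpow b hab.le
  set R := H * (K * (2 * a) ^ (d - 1)) with hR
  have hmax : ∀ z, a ≤ z → z ≤ a + H → p.eval z ≤ p.eval a + R := by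
    intro z h1 h2
    have h3 := hg.sub_le a z ha₀ h1
    have h4 : (z - a) * (K * z ^ (d - 1)) ≤ R := by
      have : z ^ (d - 1) ≤ (2 * a) ^ (d - 1) := pow_le_pow_left₀ (by omega) (by omega) _
      have hz0 : 0 ≤ z := by omega
      exact mul_le_mul (by omega) (mul_le_mul_of_nonneg_left this (by omega)) (by positivity) hH0
    linarith
  have hmin : ∀ z, a ≤ z → p.eval a ≤ p.eval z := by
    intro z h1
    have h2 := hg.le_sub a z ha₀ h1
    have : 0 ≤ (z - a) * a ^ (d - 1) := mul_nonneg (by omega) (by positivity)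
    linarith
  have hR0 : 0 ≤ R := by positivity
  have hadd : a ^ d = a ^ (d - 1) * a := by rw [← pow_succ, show d - 1 + 1 = d by omega]
  have h2dd : (2 : ℤ) ^ d = 2 ^ (d - 1) * 2 := by rw [← pow_succ, show d - 1 + 1 = d by omega]
  have hRa : 16 * R ≤ a ^ d := by
    rw [hR, mul_pow, hadd]
    rw [h2dd] at hHa
    have h0 : (0 : ℤ) ≤ a ^ (d - 1) := by positivity
    have := mul_le_mul_of_nonneg_left hHa h0
    nlinarith [this]
  have hbig : (8 * Q + 100) * a ≤ a ^ d := by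
    rw [hadd]
    nlinarith [hpow a le_rfl]
  have hpa := hg.pow_le a ha₀
  set C : Set ℤ := {z | a ≤ z ∧ z ≤ a + H ∧ z ∉ Z} with hC
  -- All `z ∈ C` are at most `a + H ≤ 2 a`, so summands above `2 a` automatically differ from `z`.
  have hav : Avoids χ χ p.eval (2 * a + 1) C := by
    intro z hz x y hx hy hxy hs
    exact hclean z hz.1 hz.2.1 hz.2.2 x y (by omega) (by omega) hxy
      (by have := hz.2.1; omega) (by have := hz.2.1; omega) hs
  refine hav.no_alternation (a := a) (b := b) (c := c) (Q := Q) (R := R) ⟨le_rfl, by omega, ha⟩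
    ⟨by omega, by omega, hb⟩ ⟨by omega, hcH, hc⟩ hχab hχac (fun z hz => hmin z hz.1)
    (fun z hz => hmax z hz.1 hz.2.1) ?_ (by omega) (by omega) hQ0.le ?_
  · intro P hP h
    exact period_bound (by omega) hl hpar (by rw [hQ, topDiff, hdeg] at hH; rw [hdeg]; exact hH) hmax hR0 hP
      fun z h1 h2 h3 => h z ⟨h1, h2, h3⟩
  · nlinarith

set_option maxHeartbeats 1000000 in
/-- Adjacent clean elements of different colours do not exist at a scale where the
exceptional set `Z` is sparse. -/
theorem no_flip {p : ℤ[X]} {d : ℕ} {z₀ K : ℤ} (hd : 2 ≤ d) (hdeg : p.natDegree = d)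
    (hl : 0 < p.leadingCoeff) (hpar : 2 ∣ p.eval 1 * p.eval 2) (hg : GrowthBounds p d z₀ K)
    {χ : ℤ → Bool} {Z : Finset ℤ} {z z' G : ℤ} {J : ℕ}
    (hclean : ∀ w, z ≤ 2 * w → w ≤ 2 * z → w ∉ Z → IsClean χ p.eval w)
    (hz : z ∉ Z) (hz' : z' ∉ Z) (hlt : z < z') (hgap : z' - z ≤ G) (hχ : χ z ≠ χ z')
    (hG : (Z.card : ℤ) + 2 ≤ G) (hz₀ : 2 * z₀ ≤ z) (hzQ : 2 ^ (d + 2) * (16 * topDiff p + 200) ≤ z)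
    (hGJ : G ≤ 2 ^ J) (hGz : G * z ^ (d - 1) ≤ 2 ^ (d * J))
    (hJ : K ^ 2 * 2 ^ (4 * d + 4) * (8 * (topDiff p + d + 4)) * ((J + 1) * 2 ^ J) ≤ z) : False := by
  have hQ0 := topDiff_pos hl
  set Q := topDiff p with hQ
  have hK := hg.one_le_const
  set T : ℤ := 2 ^ J with hT
  have hT1 : 1 ≤ T := one_le_pow₀ (by norm_num)
  -- Within `H = cH * T` there is room for progressions of `d + 1` terms with steps up to `T` and
  -- for a run of `Q` integers, all avoiding `Z`.
  set cH : ℤ := 8 * (Q + d + 4) with hcH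
  set H : ℤ := cH * T with hH
  have h2d : (4 : ℤ) ≤ 2 ^ d := by
    calc (4 : ℤ) = 2 ^ 2 := by norm_num
      _ ≤ 2 ^ d := pow_le_pow_right₀ (by norm_num) hd
  set E : ℤ := 2 ^ d with hE
  have e2 : (2 : ℤ) ^ (d + 2) = 4 * E := by rw [pow_add]; ring
  have e4 : (2 : ℤ) ^ (4 * d + 4) = 16 * E ^ 4 := by rw [pow_add, hE, ← pow_mul]; ring
  rw [e2] at hzQ
  rw [e4] at hJ
  have hG2 : 2 ≤ G := by have : (0 : ℤ) ≤ Z.card := by positivity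
                         omega
  have hd' : (2 : ℤ) ≤ d := by exact_mod_cast hd
  have hHG : 8 * (Q + d + 4) * G ≤ H := mul_le_mul_of_nonneg_left hGJ (by omega)
  have hHT : 8 * (Q + d + 4) * T = H := rfl
  have hQG : Q * 2 ≤ Q * G := mul_le_mul_of_nonneg_left hG2 hQ0.le
  have hQG' : Q * Z.card ≤ Q * G := mul_le_mul_of_nonneg_left (by omega) hQ0.le
  have hdG : (d : ℤ) * 2 ≤ d * G := mul_le_mul_of_nonneg_left hG2 (by omega)
  have hdG' : (d : ℤ) * Z.card ≤ d * G := mul_le_mul_of_nonneg_left (by omega) (by omega)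
  have hHG' : 8 * (Q * G) + 8 * (d * G) + 32 * G ≤ H := by linarith
  have hHT' : 8 * (Q * T) + 8 * (d * T) + 32 * T ≤ H := by linarith
  have hcH0 : 0 < cH := by omega
  have hH0 : 0 ≤ H := by positivity
  have hJ0 : (0 : ℤ) ≤ J := by positivity
  have hK0 : 0 < K := by omega
  have hE0 : 0 < E := by omega
  have hG0 : 0 < G := by omega
  have hT0 : 0 < T := by omega
  have hzQ' : 16 * Q + 200 ≤ z :=
    (le_mul_of_one_le_left (by omega) (by omega)).trans hzQ
  have hzpos : 0 < z := by omega
  have hHz : 64 * K * E * H ≤ z := by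
    refine le_trans ?_ hJ
    have h1 : T ≤ ((J : ℤ) + 1) * T := le_mul_of_one_le_left (by omega) (by omega)
    have h2 : 64 * K * E ≤ K ^ 2 * (16 * E ^ 4) := by
      have a1 : K ≤ K ^ 2 := le_self_pow₀ hK (by norm_num)
      have a2 : 4 * E ≤ E ^ 4 := by nlinarith [pow_le_pow_left₀ (by norm_num) h2d 3]
      have : K * (4 * E) ≤ K ^ 2 * E ^ 4 := mul_le_mul a1 a2 (by positivity) (by positivity)
      linarith
    calc 64 * K * E * H = (64 * K * E) * cH * T := by rw [hH]; ring
      _ ≤ (K ^ 2 * (16 * E ^ 4)) * cH * T := by gcongr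
      _ ≤ K ^ 2 * (16 * E ^ 4) * cH * (((J : ℤ) + 1) * T) := by gcongr
  have hH256 : 256 * H ≤ z := by
    have : 1 * 4 ≤ K * E := mul_le_mul hK h2d (by norm_num) (by omega)
    have := mul_le_mul_of_nonneg_right this hH0
    linarith
  have hcl : ∀ a, z - H / 4 ≤ a → a ≤ z → ∀ w, a ≤ w → w ≤ a + H → w ∉ Z → IsClean χ p.eval w :=
    fun a h1 h2 w h3 h4 h5 => hclean w (by omega) (by omega) h5
  have alt : ∀ a b c, z - H / 4 ≤ a → a ≤ z → a ∉ Z → b ∉ Z → c ∉ Z → a < b → b - a + 1 ≤ c - b →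
      c ≤ a + H → χ a ≠ χ b → χ a = χ c → False := by
    intro a b c h1 h2 h3 h4 h5 h6 h7 h8 h9 h10
    refine no_alternation_of_clean hd hdeg hl hpar hg (hcl a h1 h2) h3 h4 h5 h6 h7 h8 h9 h10
      ?_ (by omega) (by omega) ?_
    · have h0 : (Q + d + 2) * (Z.card + 1 : ℤ) ≤ (Q + d + 2) * G :=
        mul_le_mul_of_nonneg_left (by omega) (by omega)
      have h1 : (Q + d + 2) * G = Q * G + d * G + 2 * G := by ring
      have h2 : 0 ≤ Q * G := by positivity
      have h3 : 0 ≤ (d : ℤ) * G := by positivity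
      change (Q + d + 2) * (Z.card + 1 : ℤ) ≤ H
      omega
    · have h1 : 64 * K * E * H = 2 * (32 * K * E * H) := by ring
      rw [h1] at hHz
      change 32 * K * E * H ≤ a
      omega
  -- Otherwise `z`, `z'`, `c` alternate; the margin `2 G + 1` makes the second gap the larger one.
  have above : ∀ c, z + 2 * G + 1 ≤ c → c ≤ z + H → c ∉ Z → χ c ≠ χ z := by
    intro c h1 h2 h3 h4
    exact alt z z' c (by omega) le_rfl hz hz' h3 hlt (by omega) h2 hχ h4.symm
  -- Otherwise `a`, `z` and a clean element near `z + H / 2` alternate.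
  have below : ∀ a, z - H / 4 ≤ a → a < z → a ∉ Z → χ a = χ z := by
    intro a h1 h2 h3
    by_contra hne
    obtain ⟨c, hc1, hc2, hc3⟩ := exists_mem_Icc_notMem Z (G := G) (by omega) (z + H / 2)
    have hc4 := above c (by omega) (by omega) hc3
    refine alt a z c h1 h2.le h3 hz hc3 h2 (by omega) (by omega) hne ?_
    revert hne hc4
    cases χ a <;> cases χ z <;> cases χ c <;> simp
  set B : Set ℤ := {b | z + 2 * G + 1 ≤ b ∧ b ≤ z + H ∧ b ∉ Z} with hB
  set M := AddSubmonoid.closure ((fun b => p.eval b - p.eval z) '' B) with hM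
  have hBM : ∀ b ∈ B, p.eval b - p.eval z ∈ M := fun b hb =>
    AddSubmonoid.subset_closure ⟨b, hb, rfl⟩
  have hz0z : z₀ ≤ z := by have := hg.one_le_start; omega
  have hpowz : z ≤ z ^ (d - 1) := le_self_pow₀ (by omega) (by omega)
  have hDlow : ∀ b ∈ B, 2 * z + 1 ≤ p.eval b - p.eval z := by
    intro b hb
    have h1 := hg.le_sub z b hz0z (by have := hb.1; omega)
    have h2 : 5 * z ^ (d - 1) ≤ (b - z) * z ^ (d - 1) :=
      mul_le_mul_of_nonneg_right (by have := hb.1; omega) (by positivity)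
    omega
  have h2dd : (2 : ℤ) ^ (d - 1) * 2 = E := by rw [← pow_succ, show d - 1 + 1 = d by omega]
  have hDup : ∀ b w, z ≤ b → b ≤ z + H → b - z ≤ w →
      2 * (p.eval b - p.eval z) ≤ w * K * E * z ^ (d - 1) := by
    intro b w h1 h2 h3
    have h4 := hg.sub_le z b hz0z h1
    have h5 : b ^ (d - 1) ≤ (2 * z) ^ (d - 1) := pow_le_pow_left₀ (by omega) (by omega) _
    have hb0 : 0 ≤ b := by omega
    have h6 : (b - z) * (K * b ^ (d - 1)) ≤ w * (K * (2 * z) ^ (d - 1)) :=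
      mul_le_mul h3 (mul_le_mul_of_nonneg_left h5 (by omega)) (by positivity) (by omega)
    rw [mul_pow] at h6
    rw [← h2dd]
    linarith
  set W : ℤ := z ^ (d - 1) with hW
  have hzd : z ^ d = W * z := by rw [hW, ← pow_succ, show d - 1 + 1 = d by omega]
  -- the coarsest approximation
  obtain ⟨b₀, hb₀1, hb₀2, hb₀3⟩ := exists_mem_Icc_notMem Z (G := G) (by omega) (z + 2 * G + 1)
  have hb₀ : b₀ ∈ B := ⟨hb₀1, by omega, hb₀3⟩
  have hD₀ := hDlow b₀ hb₀
  have app₀ : Approximates M (p.eval b₀ - p.eval z) 0 :=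
    approximates_of_mem (hBM b₀ hb₀) (by omega)
  have hscale : ∀ j ≤ J, ∃ u ∈ M, u ≤ E * (H * K * E * W) ∧ u + Q * 2 ^ (d * j) ∈ M := by
    intro j hj
    obtain ⟨c, hc1, hc2, hc3⟩ := exists_progression_notMem Z (z + 2 * G + 1) (2 ^ j) d
    have hjT : (2 : ℤ) ^ j ≤ T := pow_le_pow_right₀ (by norm_num) hj
    have hcB : ∀ k ≤ d, c + (k : ℤ) * 2 ^ j ∈ B := by
      intro k hk
      have hk' : (k : ℤ) ≤ d := by exact_mod_cast hk
      have h1 : (0 : ℤ) ≤ (k : ℤ) * 2 ^ j := by positivity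
      have h2 : (k : ℤ) * 2 ^ j ≤ d * T := mul_le_mul hk' hjT (by positivity) (by positivity)
      have h3 : 0 ≤ (d : ℤ) * G := by positivity
      have h4 : 0 ≤ Q * G := by positivity
      have h5 : 0 ≤ Q * T := by positivity
      have hc2' : c ≤ z + 2 * G + 1 + (d * Z.card + Z.card) := by linarith
      exact ⟨by omega, by omega, hc3 k hk⟩
    have h := exists_mem_add_factorial_mem p (by omega) c (p.eval z) (H * K * E * W)
      (h := 2 ^ j) (by positivity) M (by rw [hdeg]; exact fun k hk => hBM _ (hcB k hk))
      (by
        rw [hdeg]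
        intro k hk
        have hb := hcB k hk
        have := hDup _ H (by have := hb.1; omega) hb.2.1 (by have := hb.2.1; omega)
        have : 0 ≤ H * K * E * W := by positivity
        omega) (by positivity)
    rw [hdeg] at h
    rw [pow_mul', hQ, topDiff, hdeg]
    exact h
  -- The initial error is at most `2 K E G z^(d-1) ≤ 2 K E 2^(d J)`; the steps `2^J, ..., 1` reduce
  -- it to `Q`.
  have happ : Approximates M Q (((2 * K * E).toNat + 2 ^ d * J) * (E * (H * K * E * W))) := by
    refine app₀.refine_scales hQ0 (k := (2 * K * E).toNat) ?_ hscale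
    rw [Int.toNat_of_nonneg (by positivity)]
    have h1 := hDup b₀ (4 * G) (by omega) (by omega) (by omega)
    have h2 : 2 * K * E * (G * W) ≤ 2 * K * E * 2 ^ (d * J) := by gcongr
    have h3 : 2 * K * E * 2 ^ (d * J) ≤ 2 * K * E * (Q * 2 ^ (d * J)) := by
      gcongr
      exact le_mul_of_one_le_left (by positivity) (by omega)
    linarith
  rw [Int.toNat_of_nonneg (by positivity)] at happ
  -- the run and the smaller clean element
  obtain ⟨x₀, hx1, hx2, hx3⟩ := exists_progression_notMem Z (z - H / 4) 1 Q.toNat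
  have hQn : (Q.toNat : ℤ) = Q := Int.toNat_of_nonneg hQ0.le
  rw [hQn] at hx2
  have hx2' : x₀ ≤ z - H / 4 + (Q * Z.card + Z.card) := by linarith
  have hdG0 : 0 ≤ (d : ℤ) * G := by positivity
  have hrun' : x₀ + Q ≤ z := by omega
  obtain ⟨w, hw1, hw2, hw3⟩ := exists_mem_Icc_notMem Z (G := G) (by omega) (z - H / 4)
  have hpw := hg.pow_le w (by omega)
  have hwd : z ^ d ≤ E * w ^ d := by
    rw [hE, ← mul_pow]
    exact pow_le_pow_left₀ (by omega) (by omega) _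
  have hpww : w ≤ w ^ (d - 1) := le_self_pow₀ (by omega) (by omega)
  have hWz : (4 * E * (16 * Q + 200)) * z ≤ z ^ d := by
    rw [hzd]
    exact mul_le_mul_of_nonneg_right (hzQ.trans hpowz) hzpos.le
  have hEz : 0 < E * z := by positivity
  have hEQz : 0 < E * (Q * z) := by positivity
  have hzE : 4 * z ≤ E * z := mul_le_mul_of_nonneg_right h2d hzpos.le
  refine no_single_change (χ := χ) (q := p.eval) (r := z) (lo := 2 * z + 1) (B := B)
    (hclean z (by omega) (by omega) hz) ?_ (by omega) ?_ (x₀ := x₀) (by omega) hQ0 ?_ hrun' happ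
    (hclean w (by omega) (by omega) hw3) (below w hw1 (by omega) hw3) (by omega) ?_ (by positivity) ?_
  · intro b hb
    exact ⟨hclean b (by have := hb.1; omega) (by have := hb.2.1; omega) hb.2.2,
      above b hb.1 hb.2.1 hb.2.2, by have := hb.2.1; omega, hDlow b hb⟩
  · have := hg.pow_le z hz0z
    have e : 4 * E * (16 * Q + 200) * z = 64 * (E * (Q * z)) + 800 * (E * z) := by ring
    omega
  · intro x h1 h2
    have h3 := hx3 (x - x₀).toNat (by omega)
    rw [Int.toNat_of_nonneg (by omega), mul_one, add_sub_cancel] at h3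
    exact below x (by omega) (by omega) h3
  · have hY : 8 * E * ((2 * K * E + 2 ^ d * J) * (E * (H * K * E * W))) ≤ z ^ d := by
      have h1 : 2 * K * E + 2 ^ d * J ≤ 2 * K * E * (J + 1) := by
        rw [← hE]
        nlinarith [mul_nonneg (by omega : 0 ≤ K - 1) (mul_nonneg (by omega : 0 ≤ E) hJ0),
          mul_nonneg (by omega : 0 ≤ E) hJ0]
      have h2 : 8 * E * ((2 * K * E + 2 ^ d * J) * (E * (H * K * E * W)))
          ≤ 8 * E * ((2 * K * E * (J + 1)) * (E * (H * K * E * W))) := by gcongr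
      have h3 : 8 * E * ((2 * K * E * (J + 1)) * (E * (H * K * E * W)))
          = W * (K ^ 2 * (16 * E ^ 4) * cH * (((J : ℤ) + 1) * T)) := by rw [hH]; ring
      rw [hzd]
      rw [h3] at h2
      exact h2.trans (mul_le_mul_of_nonneg_left hJ (by positivity))
    set Y := (2 * K * E + 2 ^ d * J) * (E * (H * K * E * W))
    have h1 : 2 * E * (8 * Y + (64 * Q + 800) * z) ≤ 2 * E * (4 * p.eval w) := by
      have h3 := mul_le_mul_of_nonneg_left hpw (by positivity : 0 ≤ 4 * E)
      linarith
    have h2 : 8 * Y + (64 * Q + 800) * z ≤ 4 * p.eval w := le_of_mul_le_mul_left h1 (by positivity)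
    have h3 : 0 < Q * z := by positivity
    have h4 : (64 * Q + 800) * z = 64 * (Q * z) + 800 * z := by ring
    omega
  · have h1 := hg.le_sub w z (by omega) (by omega)
    have h2 : 16 * w ≤ (z - w) * w ^ (d - 1) :=
      mul_le_mul (by omega) hpww (by omega) (by omega)
    omega

end HigherDegree

/-! ### Degree at least two: one colour for all clean elements of a range -/

section HigherDegreeGlobal

open Polynomial

/-- If the exceptional set is sparse, all clean elements of `[A, M]` have one colour. -/
theorem color_eq_of_sparse {p : ℤ[X]} {d : ℕ} {z₀ K : ℤ} (hd : 2 ≤ d) (hdeg : p.natDegree = d)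
    (hl : 0 < p.leadingCoeff) (hpar : 2 ∣ p.eval 1 * p.eval 2) (hg : GrowthBounds p d z₀ K)
    {χ : ℤ → Bool} {Z : Finset ℤ} {A M G κ : ℤ} {L : ℕ}
    (hκ : κ = K ^ 2 * 2 ^ (4 * d + 4) * (8 * (topDiff p + d + 4)))
    (hclean : ∀ w, 1 ≤ w → w ≤ 2 * M → w ∉ Z → IsClean χ p.eval w)
    (hG : (Z.card : ℤ) + 2 ≤ G) (hA₀ : 2 * z₀ ≤ A)
    (hAQ : 2 ^ (d + 2) * (16 * topDiff p + 200) ≤ A)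
    (hGA : G * (2 * κ * L) ^ d ≤ A) (hML : M < 2 ^ L) (hL : 1 ≤ L)
    {u v : ℤ} (hu : A ≤ u) (huv : u < v) (hv : v ≤ M) (huZ : u ∉ Z) (hvZ : v ∉ Z) :
    χ u = χ v := by
  by_contra hne
  have hex : ∃ k : ℕ, ∃ u v : ℤ, v - u = k ∧ A ≤ u ∧ u < v ∧ v ≤ M ∧ u ∉ Z ∧ v ∉ Z ∧ χ u ≠ χ v :=
    ⟨(v - u).toNat, u, v, by omega, hu, huv, hv, huZ, hvZ, hne⟩
  clear! u v
  classical
  -- A pair at minimal distance has only elements of `Z` in between, so its gap is at most `G`.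
  obtain ⟨u, v, hk, hu, huv, hv, huZ, hvZ, hne⟩ := Nat.find_spec hex
  have hmin : ∀ w, u < w → w < v → w ∈ Z := by
    intro w h1 h2
    by_contra hw
    by_cases hc : χ u = χ w
    · have := Nat.find_min' hex ⟨w, v, (Int.toNat_of_nonneg (by omega : 0 ≤ v - w)).symm, by omega,
        h2, hv, hw, hvZ, by rw [← hc]; exact hne⟩
      omega
    · have := Nat.find_min' hex ⟨u, w, (Int.toNat_of_nonneg (by omega : 0 ≤ w - u)).symm, hu,
        h1, by omega, huZ, hw, hc⟩
      omega
  have hgap : v - u ≤ G := by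
    by_contra hgap
    obtain ⟨c, h1, h2, h3⟩ := exists_mem_Icc_notMem Z (G := Z.card) le_rfl (u + 1)
    exact h3 (hmin c (by omega) (by omega))
  have hQ0 := topDiff_pos hl
  have hK := hg.one_le_const
  have hκ1 : 1 ≤ κ := by
    have : 0 < κ := by rw [hκ]; positivity
    omega
  have hL' : (1 : ℤ) ≤ L := by exact_mod_cast hL
  have hκL : 1 ≤ κ * L := one_le_mul_of_one_le_of_one_le hκ1 hL'
  have hG0 : 0 < G := by have : (0 : ℤ) ≤ Z.card := by positivity
                         omega
  have hb : 2 * κ * L ≤ (2 * κ * L) ^ d := le_self_pow₀ (by linarith) (by omega)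
  have hGb : G * (2 * κ * L) ≤ u := (mul_le_mul_of_nonneg_left hb hG0.le).trans (hGA.trans hu)
  have hu0 : 0 < u := by nlinarith
  have hX : 1 ≤ u / (κ * L) := by
    rw [Int.le_ediv_iff_mul_le (by omega)]
    nlinarith
  -- `J` is chosen so that `κ L 2^J ≤ u < 2 κ L 2^J`: the upper bound yields `G u^(d-1) ≤ 2^(d J)`,
  -- the lower one the last hypothesis of `no_flip`.
  set X := (u / (κ * L)).toNat with hXdef
  have hXc : (X : ℤ) = u / (κ * L) := Int.toNat_of_nonneg (by omega)
  set J := Nat.log 2 X with hJdef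
  have hJ1 : (2 : ℤ) ^ J ≤ u / (κ * L) := by
    rw [← hXc]
    exact_mod_cast Nat.pow_log_le_self 2 (by omega)
  have hJ2 : u / (κ * L) + 1 ≤ 2 ^ (J + 1) := by
    rw [← hXc]
    exact_mod_cast Nat.lt_pow_succ_log_self (by norm_num) X
  have hup : κ * L * 2 ^ J ≤ u :=
    (mul_le_mul_of_nonneg_left hJ1 (by omega)).trans (Int.mul_ediv_self_le (by omega))
  have hlow : u < 2 * κ * L * 2 ^ J := by
    have h1 := Int.lt_mul_ediv_self_add (x := u) (by omega : 0 < κ * L)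
    have h2 := mul_le_mul_of_nonneg_left hJ2 (by omega : 0 ≤ κ * L)
    rw [pow_succ] at h2
    nlinarith
  have hJL : (J : ℤ) + 1 ≤ L := by
    have h1 : (2 : ℤ) ^ J < 2 ^ L := by
      have : (2 : ℤ) ^ J ≤ κ * L * 2 ^ J := le_mul_of_one_le_left (by positivity) hκL
      linarith
    have := (pow_lt_pow_iff_right₀ (by norm_num : (1 : ℤ) < 2)).1 h1
    omega
  refine no_flip hd hdeg hl hpar hg (z := u) (z' := v) (G := G) (J := J)
    (fun w h1 h2 h3 => hclean w (by omega) (by omega) h3) huZ hvZ huv hgap hne hG (by omega)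
    (by omega) ?_ ?_ ?_
  · have h1 : (2 * κ * L) * G < (2 * κ * L) * 2 ^ J := by linarith
    exact (lt_of_mul_lt_mul_left h1 (by nlinarith)).le
  · have h1 : u ^ d ≤ (2 * κ * L) ^ d * 2 ^ (d * J) := by
      rw [pow_mul', ← mul_pow]
      exact pow_le_pow_left₀ hu0.le hlow.le _
    have h2 : u * (G * u ^ (d - 1)) ≤ u * 2 ^ (d * J) := by
      have e : u * (G * u ^ (d - 1)) = G * u ^ d := by
        rw [show u ^ d = u ^ (d - 1) * u by rw [← pow_succ, show d - 1 + 1 = d by omega]]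
        ring
      rw [e]
      calc G * u ^ d ≤ G * ((2 * κ * L) ^ d * 2 ^ (d * J)) := mul_le_mul_of_nonneg_left h1 hG0.le
        _ = G * (2 * κ * L) ^ d * 2 ^ (d * J) := by ring
        _ ≤ u * 2 ^ (d * J) := mul_le_mul_of_nonneg_right (hGA.trans hu) (by positivity)
    exact le_of_mul_le_mul_left h2 hu0
  · rw [← hκ]
    calc κ * (((J : ℤ) + 1) * 2 ^ J) ≤ κ * (L * 2 ^ J) := by gcongr
      _ = κ * L * 2 ^ J := by ring
      _ ≤ u := hup

/-- The exceptional set of a colouring cannot be sparse. -/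
theorem not_sparse {p : ℤ[X]} {d : ℕ} {z₀ K : ℤ} (hd : 2 ≤ d) (hdeg : p.natDegree = d)
    (hl : 0 < p.leadingCoeff) (hpar : 2 ∣ p.eval 1 * p.eval 2) (hg : GrowthBounds p d z₀ K)
    {χ : ℤ → Bool} {Z : Finset ℤ} {A M G κ : ℤ} {L : ℕ}
    (hκ : κ = K ^ 2 * 2 ^ (4 * d + 4) * (8 * (topDiff p + d + 4)))
    (hclean : ∀ w, 1 ≤ w → w ≤ 2 * M → w ∉ Z → IsClean χ p.eval w)
    (hG : (Z.card : ℤ) + 2 ≤ G) (hA₀ : 2 * z₀ ≤ A)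
    (hAQ : 2 ^ (d + 2) * (16 * topDiff p + 200) ≤ A)
    (hGA : G * (2 * κ * L) ^ d ≤ A) (hM : M = K * (2 * A) ^ d) (hML : M < 2 ^ L) (hL : 1 ≤ L) :
    False := by
  have hQ0 := topDiff_pos hl
  have hK := hg.one_le_const
  have hz₀ := hg.one_le_start
  have hA : 200 ≤ A := by
    have : (1 : ℤ) ≤ 2 ^ (d + 2) := one_le_pow₀ (by norm_num)
    nlinarith
  have hκ1 : 1 ≤ κ := by
    have : 0 < κ := by rw [hκ]; positivity
    omega
  have hGA' : 2 * G ≤ A := by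
    have hL' : (1 : ℤ) ≤ L := by exact_mod_cast hL
    have hκL : 1 ≤ κ * L := one_le_mul_of_one_le_of_one_le hκ1 hL'
    have hb : 2 * κ * L ≤ (2 * κ * L) ^ d := le_self_pow₀ (by linarith) (by omega)
    have hG0 : 0 ≤ G := by omega
    nlinarith
  have hcol := fun {u v : ℤ} => color_eq_of_sparse hd hdeg hl hpar hg hκ hclean hG hA₀ hAQ hGA hML
    hL (u := u) (v := v)
  obtain ⟨z, hz1, hz2, hzZ⟩ := exists_mem_Icc_notMem Z (G := G) (by omega) A
  -- Avoiding `Z` and its reflection makes both `x` and `p z - x` clean.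
  have hcard : ((Z ∪ Z.image fun w => p.eval z - w).card : ℤ) ≤ 2 * G := by
    have h1 := Finset.card_union_le Z (Z.image fun w => p.eval z - w)
    have h2 : (Z.image fun w => p.eval z - w).card ≤ Z.card := Finset.card_image_le
    omega
  obtain ⟨x, hx1, hx2, hxZ⟩ := exists_mem_Icc_notMem _ hcard (2 * A + 1)
  rw [Finset.mem_union, not_or] at hxZ
  obtain ⟨hxZ, hyZ⟩ := hxZ
  have hyZ : p.eval z - x ∉ Z := fun h => hyZ (Finset.mem_image.2 ⟨_, h, by ring⟩)
  have hpz := hg.pow_le z (by omega)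
  have hzsq : z * z ≤ z ^ d := by
    rw [← sq]
    exact pow_le_pow_right₀ (by omega) hd
  have hzz : 200 * z ≤ z * z := mul_le_mul_of_nonneg_right (by omega) (by omega)
  have hpM : p.eval z ≤ M := by
    refine (hg.le_pow z (by omega)).trans ?_
    rw [hM]
    exact mul_le_mul_of_nonneg_left (pow_le_pow_left₀ (by omega) (by omega) _) (by omega)
  refine hclean z (by omega) (by omega) hzZ x (p.eval z - x) (by omega) (by omega) (by omega)
    (by omega) (by omega) (by dsimp only; omega) ⟨?_, ?_⟩
  · exact (hcol hz1 (by omega) (by omega) hzZ hxZ).symm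
  · exact (hcol hz1 (by omega) (by omega) hzZ hyZ).symm

end HigherDegreeGlobal

/-! ### Ordered triples with distinct entries -/

/-- The monochromatic solutions as ordered triples with distinct entries. -/
noncomputable def distinctTriples (p : Polynomial ℤ) (n : ℕ) (φ : ℕ → Bool) :
    Finset (ℕ × ℕ × ℕ) :=
  {t ∈ monoSolutionTriples p n φ | t.1 ≠ t.2.1 ∧ t.1 ≠ t.2.2 ∧ t.2.1 ≠ t.2.2}

theorem mem_distinctTriples {p : Polynomial ℤ} {n : ℕ} {φ : ℕ → Bool} {x y z : ℕ} :
    (x, y, z) ∈ distinctTriples p n φ ↔ ((1 ≤ x ∧ x ≤ n) ∧ (1 ≤ y ∧ y ≤ n) ∧ (1 ≤ z ∧ z ≤ n)) ∧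
      (φ x = φ y ∧ φ y = φ z ∧ (x : ℤ) + y = p.eval (z : ℤ)) ∧ x ≠ y ∧ x ≠ z ∧ y ≠ z := by
  simp [distinctTriples, monoSolutionTriples, and_assoc]

/-- A triple over a given 3-element set `S` lies in `S³`, which has 27 elements. -/
theorem card_distinctTriples_le (p : Polynomial ℤ) (n : ℕ) (φ : ℕ → Bool) :
    (distinctTriples p n φ).card ≤ 27 * (monoSolutionSets p n φ).card := by
  classical
  refine Finset.card_le_mul_card_image_of_maps_to
    (f := fun t : ℕ × ℕ × ℕ => ({t.1, t.2.1, t.2.2} : Finset ℕ)) ?_ 27 ?_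
  · rintro ⟨x, y, z⟩ h
    rw [mem_distinctTriples] at h
    obtain ⟨⟨hx, hy, hz⟩, ⟨h1, h2, h3⟩, h4, h5, h6⟩ := h
    simp only [monoSolutionSets, Finset.mem_filter, Finset.mem_powersetCard]
    refine ⟨⟨?_, Finset.card_eq_three.2 ⟨x, y, z, h4, h5, h6, rfl⟩⟩, x, y, z, rfl, h1, h2, h3⟩
    intro w hw
    simp only [Finset.mem_insert, Finset.mem_singleton] at hw
    rw [Finset.mem_Icc]
    rcases hw with rfl | rfl | rfl <;> assumption
  · intro S hS
    have hc : S.card = 3 := by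
      simp only [monoSolutionSets, Finset.mem_filter, Finset.mem_powersetCard] at hS
      exact hS.1.2
    have hsub : {t ∈ distinctTriples p n φ | ({t.1, t.2.1, t.2.2} : Finset ℕ) = S}
        ⊆ S ×ˢ S ×ˢ S := by
      rintro ⟨x, y, z⟩ h
      obtain ⟨-, rfl⟩ := Finset.mem_filter.1 h
      simp
    refine (Finset.card_le_card hsub).trans ?_
    rw [Finset.card_product, Finset.card_product, hc]

/-- The colouring as a function on the integers. -/
def intColor (φ : ℕ → Bool) (x : ℤ) : Bool := φ x.toNat

/-- The exceptional set: all `z` that occur in a solution. -/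
noncomputable def badSet (p : Polynomial ℤ) (n : ℕ) (φ : ℕ → Bool) : Finset ℤ :=
  (distinctTriples p n φ).image fun t => (t.2.2 : ℤ)

theorem isClean_of_notMem_badSet {p : Polynomial ℤ} {n : ℕ} {φ : ℕ → Bool} {z : ℤ} (hz : 1 ≤ z)
    (hzn : z ≤ n) (hpz : p.eval z ≤ n) (h : z ∉ badSet p n φ) : IsClean (intColor φ) p.eval z := by
  rintro x y hx hy hxy hxz hyz hs ⟨h1, h2⟩
  dsimp only at hs
  refine h (Finset.mem_image.2 ⟨(x.toNat, y.toNat, z.toNat), ?_, Int.toNat_of_nonneg (by omega)⟩)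
  rw [mem_distinctTriples]
  refine ⟨⟨⟨by omega, by omega⟩, ⟨by omega, by omega⟩, by omega, by omega⟩, ⟨h1.trans h2.symm, h2, ?_⟩,
    by omega, by omega, by omega⟩
  rw [Int.toNat_of_nonneg (by omega), Int.toNat_of_nonneg (by omega),
    Int.toNat_of_nonneg (by omega), hs]

/-- A finitary lower bound for the number of solutions in degree at least two. -/
theorem exists_lower_bound_nat (p : Polynomial ℤ) (d : ℕ) (hd : 2 ≤ d) (hdeg : p.natDegree = d)
    (hlead : 0 < p.leadingCoeff) (hpar : 2 ∣ p.eval 1 * p.eval 2) :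
    ∃ A₀ N₀ k : ℕ, 1 ≤ N₀ ∧ ∀ A n : ℕ, A₀ ≤ A → N₀ * A ^ d ^ 2 ≤ n → ∀ φ : ℕ → Bool,
      A < (27 * (monoSolutionSets p n φ).card + 2) * (k * (Nat.log 2 n + 1)) ^ d := by
  obtain ⟨z₀, K, hg⟩ := exists_growthBounds p d hd hdeg hlead
  have hQ0 := topDiff_pos hlead
  have hK := hg.one_le_const
  have hz₀ := hg.one_le_start
  obtain ⟨K', rfl⟩ := Int.eq_ofNat_of_zero_le (by omega : 0 ≤ K)
  set κ : ℤ := (K' : ℤ) ^ 2 * 2 ^ (4 * d + 4) * (8 * (topDiff p + d + 4)) with hκ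
  have hκ0 : 0 ≤ κ := by positivity
  have hK' : 1 ≤ K' := by exact_mod_cast hK
  -- `N₀ A^(d²)` equals `K (2 M)^d` with `M = K (2 A)^d`; it bounds `p` on `[1, 2 M]`, so the
  -- summands stay in `[n]`.
  refine ⟨(2 * z₀ + 2 ^ (d + 2) * (16 * topDiff p + 200)).toNat,
    K' * (2 * K' * 2 ^ d) ^ d, 2 * κ.toNat, Nat.one_le_iff_ne_zero.2 (by positivity),
    fun A n hA hn φ => ?_⟩
  by_contra hcon
  rw [not_lt] at hcon
  have hpos : 0 ≤ 2 ^ (d + 2) * (16 * topDiff p + 200) := by positivity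
  have hA' : 2 * z₀ + 2 ^ (d + 2) * (16 * topDiff p + 200) ≤ A := by
    rw [← Int.toNat_of_nonneg (by omega : 0 ≤ 2 * z₀ + 2 ^ (d + 2) * (16 * topDiff p + 200))]
    exact_mod_cast hA
  set M : ℕ := K' * (2 * A) ^ d with hM
  have hMn : K' * (2 * M) ^ d ≤ n := by
    refine le_trans (le_of_eq ?_) hn
    rw [hM, mul_pow 2 A, ← mul_assoc, ← mul_assoc, mul_pow _ (A ^ d), ← pow_mul, ← sq,
      mul_assoc K']
  have hMn' : 2 * M ≤ n := by
    refine le_trans ?_ hMn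
    refine le_trans (Nat.le_self_pow (by omega) (2 * M)) (Nat.le_mul_of_pos_left _ (by omega))
  have hcard : (badSet p n φ).card ≤ 27 * (monoSolutionSets p n φ).card :=
    Finset.card_image_le.trans (card_distinctTriples_le p n φ)
  refine not_sparse hd hdeg hlead hpar hg (χ := intColor φ) (Z := badSet p n φ) (A := A) (M := M)
    (G := 27 * (monoSolutionSets p n φ).card + 2) (L := Nat.log 2 n + 1) hκ ?_ ?_ (by omega)
    (by omega) ?_ ?_ ?_ (by omega)
  · intro w h1 h2 h3
    refine isClean_of_notMem_badSet h1 (by omega) ((hg.le_pow w h1).trans ?_) h3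
    refine le_trans ?_ (by exact_mod_cast hMn : ((K' : ℤ) * (2 * M) ^ d) ≤ n)
    exact mul_le_mul_of_nonneg_left (pow_le_pow_left₀ (by omega) h2 _) (by omega)
  · have : ((badSet p n φ).card : ℤ) ≤ 27 * (monoSolutionSets p n φ).card := by exact_mod_cast hcard
    linarith
  · rw [← Int.toNat_of_nonneg hκ0]
    exact_mod_cast hcon
  · rw [hM]
    push_cast
    rfl
  · have : n < 2 ^ (Nat.log 2 n + 1) := Nat.lt_pow_succ_log_self (by norm_num) n
    have h2 : M < 2 ^ (Nat.log 2 n + 1) := by omega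
    exact_mod_cast h2

/-! ### From the finitary bound to exponents -/

open Filter in
theorem eventually_mul_log_pow_le_rpow (C : ℝ) (d : ℕ) {ε : ℝ} (hε : 0 < ε) :
    ∀ᶠ n : ℕ in atTop, C * Real.log n ^ d ≤ (n : ℝ) ^ ε := by
  have h := (isLittleO_log_rpow_rpow_atTop (d : ℝ) hε).const_mul_left C
  have h2 := h.comp_tendsto tendsto_natCast_atTop_atTop
  have h3 := h2.bound (by norm_num : (0 : ℝ) < 1)
  filter_upwards [h3] with n hn
  simp only [Function.comp_apply, Real.rpow_natCast, one_mul, Real.norm_eq_abs] at hn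
  rw [abs_of_nonneg (by positivity : 0 ≤ (n : ℝ) ^ ε)] at hn
  exact (le_abs_self _).trans hn

theorem natLog_add_one_le {n : ℕ} (hn : 3 ≤ n) : ((Nat.log 2 n : ℝ) + 1) ≤ 3 * Real.log n := by
  have h1 : (Nat.log 2 n : ℝ) * Real.log 2 ≤ Real.log n := by
    rw [← Real.log_pow]
    apply Real.log_le_log (by positivity)
    exact_mod_cast Nat.pow_log_le_self 2 (by omega)
  have h2 : (1 : ℝ) ≤ Real.log n := by
    rw [Real.le_log_iff_exp_le (by positivity)]
    have : (3 : ℝ) ≤ n := by exact_mod_cast hn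
    linarith [Real.exp_one_lt_d9]
  have h3 := Real.log_two_gt_d9
  have h4 : (0 : ℝ) ≤ Nat.log 2 n := by positivity
  nlinarith

open Filter in
theorem eventually_rpow_le_card_of_two_le (p : Polynomial ℤ) (d : ℕ) (hd : 2 ≤ d)
    (hdeg : p.natDegree = d) (hlead : 0 < p.leadingCoeff) (hpar : 2 ∣ p.eval 1 * p.eval 2)
    {ε : ℝ} (hε : 0 < ε) :
    ∀ᶠ n : ℕ in atTop, ∀ φ : ℕ → Bool,
      (n : ℝ) ^ (2 / (d : ℝ) ^ 3 - ε) ≤ ((monoSolutionSets p n φ).card : ℝ) := by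
  obtain ⟨A₀, N₀, k, hN₀, H⟩ := exists_lower_bound_nat p d hd hdeg hlead hpar
  have hd' : (2 : ℝ) ≤ d := by exact_mod_cast hd
  set θ : ℝ := 1 / (d : ℝ) ^ 2 with hθ
  have hθ0 : 0 < θ := by positivity
  have hle : 2 / (d : ℝ) ^ 3 ≤ θ := by
    rw [hθ, div_le_div_iff₀ (by positivity) (by positivity)]
    nlinarith [sq_nonneg (d : ℝ), mul_le_mul_of_nonneg_right hd' (sq_nonneg (d : ℝ))]
  -- With `δ ≤ θ / 2` the power `n^(θ - δ)` is at least 1 and absorbs the summand 2, whence the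
  -- constant `29 = 27 + 2`.
  set δ := min ε (θ / 2) with hδ
  have hδ0 : 0 < δ := lt_min hε (by positivity)
  have hδ1 : δ ≤ ε := min_le_left _ _
  have hδ2 : δ ≤ θ / 2 := min_le_right _ _
  have hN0 : (0 : ℝ) < N₀ := by exact_mod_cast hN₀
  have htend : Tendsto (fun n : ℕ => ((n : ℝ) / N₀) ^ θ) atTop atTop :=
    (tendsto_rpow_atTop hθ0).comp
      ((tendsto_natCast_atTop_atTop).atTop_div_const hN0)
  filter_upwards [eventually_mul_log_pow_le_rpow (29 * (N₀ : ℝ) ^ θ * (3 * k) ^ d) d hδ0,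
    htend.eventually_ge_atTop (A₀ : ℝ), eventually_ge_atTop 3] with n h1 h2 h3 φ
  have hn1 : (1 : ℝ) ≤ n := by exact_mod_cast (by omega : 1 ≤ n)
  have hn0 : (0 : ℝ) < n := by linarith
  set c := (monoSolutionSets p n φ).card with hc
  refine (Real.rpow_le_rpow_of_exponent_le hn1 (by linarith :
    2 / (d : ℝ) ^ 3 - ε ≤ θ - δ)).trans ?_
  by_contra hlt
  rw [not_le] at hlt
  set A := ⌊((n : ℝ) / N₀) ^ θ⌋₊ with hA
  have hAle : (A : ℝ) ≤ ((n : ℝ) / N₀) ^ θ := Nat.floor_le (by positivity)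
  have hAn : N₀ * A ^ d ^ 2 ≤ n := by
    have e : (((n : ℝ) / N₀) ^ θ) ^ (d ^ 2) = n / N₀ := by
      rw [← Real.rpow_natCast, ← Real.rpow_mul (by positivity), hθ]
      push_cast
      rw [one_div_mul_cancel (by positivity), Real.rpow_one]
    have h4 : (A : ℝ) ^ (d ^ 2) ≤ n / N₀ := by
      rw [← e]
      exact pow_le_pow_left₀ (by positivity) hAle _
    rw [le_div_iff₀ hN0, mul_comm] at h4
    exact_mod_cast h4
  have hlow := H A n (Nat.le_floor h2) hAn φ
  rw [← hc] at hlow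
  have h5 : ((n : ℝ) / N₀) ^ θ < (27 * (c : ℝ) + 2) * (k * (Nat.log 2 n + 1)) ^ d := by
    refine (Nat.lt_floor_add_one _).trans_le ?_
    exact_mod_cast hlow
  have hone : 1 ≤ (n : ℝ) ^ (θ - δ) := Real.one_le_rpow hn1 (by linarith)
  have h6 : (27 * (c : ℝ) + 2) * (k * (Nat.log 2 n + 1)) ^ d
      ≤ (29 * (n : ℝ) ^ (θ - δ)) * ((3 * k) ^ d * Real.log n ^ d) := by
    rw [← mul_pow]
    refine mul_le_mul (by linarith) (pow_le_pow_left₀ (by positivity) ?_ _) (by positivity)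
      (by positivity)
    calc (k : ℝ) * (Nat.log 2 n + 1) ≤ k * (3 * Real.log n) :=
          mul_le_mul_of_nonneg_left (natLog_add_one_le h3) (by positivity)
      _ = 3 * k * Real.log n := by ring
  have h7 : ((n : ℝ) / N₀) ^ θ = (n : ℝ) ^ (θ - δ) * (n : ℝ) ^ δ / (N₀ : ℝ) ^ θ := by
    rw [Real.div_rpow hn0.le hN0.le, ← Real.rpow_add hn0, sub_add_cancel]
  rw [h7, div_lt_iff₀ (by positivity)] at h5
  have h8 := mul_le_mul_of_nonneg_left h1 (by positivity : 0 ≤ (n : ℝ) ^ (θ - δ))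
  have h9 := mul_le_mul_of_nonneg_right h6 (by positivity : 0 ≤ (N₀ : ℝ) ^ θ)
  nlinarith

/-- From bounds with every loss `ε` to a bound with a loss that tends to zero. -/
theorem exists_tendsto_zero_rpow_sub_le (s : ℝ) (F : ℕ → (ℕ → Bool) → ℕ)
    (h : ∀ ε : ℝ, 0 < ε → ∀ᶠ n : ℕ in Filter.atTop, ∀ φ, (n : ℝ) ^ (s - ε) ≤ (F n φ : ℝ)) :
    ∃ e : ℕ → ℝ, Filter.Tendsto e Filter.atTop (nhds 0) ∧
      ∀ᶠ n : ℕ in Filter.atTop, ∀ φ, (n : ℝ) ^ (s - e n) ≤ (F n φ : ℝ) := by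
  have hmin : ∀ n, ∃ φ₀, ∀ φ, F n φ₀ ≤ F n φ := fun n =>
    ⟨Function.argmin (F n), fun φ => Function.argmin_le (F n) φ⟩
  choose φ₀ hφ₀ using hmin
  -- The exact loss for the worst colouring of each `n`, cut off at 0.
  set e : ℕ → ℝ := fun n => max 0 (s - Real.log (F n (φ₀ n)) / Real.log n) with he
  have hlog : ∀ n : ℕ, 2 ≤ n → 0 < Real.log n := fun n hn =>
    Real.log_pos (by exact_mod_cast (by omega : 1 < n))
  refine ⟨e, ?_, ?_⟩
  · refine tendsto_order.2 ⟨fun a ha => Filter.Eventually.of_forall fun n =>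
      ha.trans_le (le_max_left _ _), fun ε hε => ?_⟩
    filter_upwards [h (ε / 2) (by positivity), Filter.eventually_ge_atTop 2] with n hn hn2
    have hn0 : (0 : ℝ) < n := by exact_mod_cast (by omega : 0 < n)
    have h1 := Real.log_le_log (by positivity) (hn (φ₀ n))
    rw [Real.log_rpow hn0, ← le_div_iff₀ (hlog n hn2)] at h1
    exact max_lt hε (by linarith)
  · filter_upwards [h 1 one_pos, Filter.eventually_ge_atTop 2] with n hn hn2 φ
    have hn0 : (0 : ℝ) < n := by exact_mod_cast (by omega : 0 < n)
    have hF : (0 : ℝ) < F n (φ₀ n) := lt_of_lt_of_le (by positivity) (hn (φ₀ n))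
    have h1 : s - e n ≤ Real.log (F n (φ₀ n)) / Real.log n := by
      have := le_max_right 0 (s - Real.log (F n (φ₀ n)) / Real.log n)
      simp only [he]
      linarith
    have hn1 : (1 : ℝ) ≤ n := by exact_mod_cast (by omega : 1 ≤ n)
    refine (Real.rpow_le_rpow_of_exponent_le hn1 h1).trans ?_
    rw [Real.rpow_def_of_pos hn0, mul_div_cancel₀ _ (hlog n hn2).ne', Real.exp_log hF]
    exact_mod_cast hφ₀ n φ

/-! ### The upper bound -/

theorem card_monoSolutionSets_le (p : Polynomial ℤ) (n : ℕ) (φ : ℕ → Bool) :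
    (monoSolutionSets p n φ).card ≤ (monoSolutionTriples p n φ).card := by
  classical
  refine le_trans (Finset.card_le_card (t := (monoSolutionTriples p n φ).image
    fun t => ({t.1, t.2.1, t.2.2} : Finset ℕ)) fun S hS => ?_) Finset.card_image_le
  simp only [monoSolutionSets, Finset.mem_filter, Finset.mem_powersetCard] at hS
  obtain ⟨⟨hsub, -⟩, x, y, z, rfl, h1, h2, h3⟩ := hS
  refine Finset.mem_image.2 ⟨(x, y, z), ?_, rfl⟩
  simp only [monoSolutionTriples, Finset.mem_filter, Finset.mem_product]
  exact ⟨⟨hsub (by simp), hsub (by simp), hsub (by simp)⟩, h1, h2, h3⟩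

/-- The colouring whose one class is `{x ≤ T₂ : p x > 2 T₂}` has few solutions. -/
theorem exists_coloring_card_le (p : Polynomial ℤ) (n T₁ T₂ : ℕ)
    (h₂ : ∀ z : ℕ, p.eval (z : ℤ) ≤ 2 * n → z ≤ T₂)
    (h₁ : ∀ z : ℕ, p.eval (z : ℤ) ≤ 2 * T₂ → z ≤ T₁) :
    ∃ φ : ℕ → Bool, (monoSolutionTriples p n φ).card ≤ 2 * (T₁ + 1) ^ 2 := by
  classical
  set φ : ℕ → Bool := fun x => decide (x ≤ T₂ ∧ 2 * (T₂ : ℤ) < p.eval (x : ℤ)) with hφ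
  refine ⟨φ, ?_⟩
  set r := Finset.range (T₁ + 1) with hr
  set f : ℕ × ℕ → ℕ × ℕ × ℕ := fun t => (t.1, (p.eval (t.2 : ℤ) - t.1).toNat, t.2) with hf
  set g : ℕ × ℕ → ℕ × ℕ × ℕ := fun t => ((p.eval (t.2 : ℤ) - t.1).toNat, t.1, t.2) with hgg
  have hsub : monoSolutionTriples p n φ ⊆ (r ×ˢ r).image f ∪ (r ×ˢ r).image g := by
    rintro ⟨x, y, z⟩ h
    simp only [monoSolutionTriples, Finset.mem_filter, Finset.mem_product, Finset.mem_Icc] at h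
    obtain ⟨⟨⟨hx1, hx2⟩, ⟨hy1, hy2⟩, hz1, hz2⟩, h1, h2, h3⟩ := h
    have hzT : z ≤ T₂ := h₂ z (by omega)
    simp only [hφ, decide_eq_decide] at h1 h2
    -- If `z` is in the first class, so are `x` and `y`; then `x + y ≤ 2 T₂ < p z`. Otherwise `p z ≤
    -- 2 T₂`, so `x` or `y` is at most `T₂`, and being outside the class it is at most `T₁`.
    by_cases hz : 2 * (T₂ : ℤ) < p.eval (z : ℤ)
    · have := h2.2 ⟨hzT, hz⟩
      have := h1.2 this
      omega
    · rw [not_lt] at hz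
      have hzT₁ := h₁ z hz
      have small : ∀ w : ℕ, w ≤ T₂ → ¬ (w ≤ T₂ ∧ 2 * (T₂ : ℤ) < p.eval (w : ℤ)) → w ≤ T₁ :=
        fun w hw hn => h₁ w (by by_contra hc; exact hn ⟨hw, by omega⟩)
      have hny : ¬ (y ≤ T₂ ∧ 2 * (T₂ : ℤ) < p.eval (y : ℤ)) := fun h => by
        have := h2.1 h
        omega
      have hnx : ¬ (x ≤ T₂ ∧ 2 * (T₂ : ℤ) < p.eval (x : ℤ)) := fun h => hny (h1.1 h)
      rw [Finset.mem_union]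
      by_cases hxT : x ≤ T₂
      · left
        have := small x hxT hnx
        refine Finset.mem_image.2 ⟨(x, z), by simp [hr]; omega, ?_⟩
        simp only [hf, Prod.mk.injEq, true_and, and_true]
        omega
      · right
        have := small y (by omega) hny
        refine Finset.mem_image.2 ⟨(y, z), by simp [hr]; omega, ?_⟩
        simp only [hgg, Prod.mk.injEq, and_true]
        omega
  refine (Finset.card_le_card hsub).trans ((Finset.card_union_le _ _).trans ?_)
  have hc : (r ×ˢ r).card = (T₁ + 1) ^ 2 := by rw [Finset.card_product, hr, Finset.card_range, sq]
  have c1 : ((r ×ˢ r).image f).card ≤ (r ×ˢ r).card := Finset.card_image_le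
  have c2 : ((r ×ˢ r).image g).card ≤ (r ×ˢ r).card := Finset.card_image_le
  omega

theorem exists_coloring_card_le_rpow (p : Polynomial ℤ) (d : ℕ) (hd : 1 ≤ d)
    (hdeg : p.natDegree = d) (hlead : 0 < p.leadingCoeff) :
    ∃ C : ℝ, ∀ n : ℕ, 1 ≤ n → ∃ φ : ℕ → Bool,
      ((monoSolutionTriples p n φ).card : ℝ) ≤ C * (n : ℝ) ^ (2 / (d : ℝ) ^ 2) := by
  obtain ⟨S, hS1, hS⟩ := exists_forall_pow_le_two_mul_eval p d hdeg.le (by rw [← hdeg]; exact hlead)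
  have hd0 : (0 : ℝ) < d := by exact_mod_cast hd
  set θ : ℝ := 1 / d with hθ
  have hθ0 : 0 < θ := by positivity
  have inv : ∀ (N : ℕ), ∀ z : ℕ, p.eval (z : ℤ) ≤ 2 * N →
      z ≤ S.toNat + ⌊(4 * (N : ℝ)) ^ θ⌋₊ := by
    intro N z hz
    by_cases hzS : (z : ℤ) < S
    · omega
    · have h1 := hS z (by omega)
      have h2 : (z : ℝ) ^ d ≤ 4 * N := by
        have : (z : ℤ) ^ d ≤ 4 * N := by omega
        exact_mod_cast this
      have h3 : (z : ℝ) ≤ (4 * (N : ℝ)) ^ θ := by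
        have := Real.rpow_le_rpow (by positivity) h2 hθ0.le
        rwa [← Real.rpow_natCast, ← Real.rpow_mul (by positivity), hθ, mul_one_div_cancel hd0.ne',
          Real.rpow_one] at this
      have := Nat.le_floor h3
      omega
  set s : ℝ := ((S.toNat : ℕ) : ℝ) with hs
  have hs0 : 0 ≤ s := by positivity
  set C₂ : ℝ := s + 4 ^ θ with hC₂
  set C₁ : ℝ := s + (4 * C₂) ^ θ with hC₁
  refine ⟨2 * (C₁ + 1) ^ 2, fun n hn => ?_⟩
  have hn1 : (1 : ℝ) ≤ n := by exact_mod_cast hn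
  set T₂ := S.toNat + ⌊(4 * (n : ℝ)) ^ θ⌋₊ with hT₂
  set T₁ := S.toNat + ⌊(4 * (T₂ : ℝ)) ^ θ⌋₊ with hT₁
  obtain ⟨φ, hφ⟩ := exists_coloring_card_le p n T₁ T₂ (inv n) (inv T₂)
  refine ⟨φ, ?_⟩
  have hC₂0 : 0 ≤ C₂ := by positivity
  have hC₁0 : 0 ≤ C₁ := by positivity
  have b2 : (T₂ : ℝ) ≤ C₂ * (n : ℝ) ^ θ := by
    have h1 : ((⌊(4 * (n : ℝ)) ^ θ⌋₊ : ℕ) : ℝ) ≤ (4 * (n : ℝ)) ^ θ := Nat.floor_le (by positivity)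
    have h3 : (4 * (n : ℝ)) ^ θ = 4 ^ θ * (n : ℝ) ^ θ :=
      Real.mul_rpow (by norm_num) (by positivity)
    have h2 : 1 ≤ (n : ℝ) ^ θ := Real.one_le_rpow hn1 hθ0.le
    rw [hT₂, Nat.cast_add, hC₂, add_mul]
    have := mul_le_mul_of_nonneg_left h2 hs0
    linarith
  have b1 : (T₁ : ℝ) ≤ C₁ * (n : ℝ) ^ (θ * θ) := by
    have h1 : ((⌊(4 * (T₂ : ℝ)) ^ θ⌋₊ : ℕ) : ℝ) ≤ (4 * (T₂ : ℝ)) ^ θ :=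
      Nat.floor_le (by positivity)
    have h3 : (4 * (T₂ : ℝ)) ^ θ ≤ (4 * C₂) ^ θ * (n : ℝ) ^ (θ * θ) := by
      rw [Real.rpow_mul (by positivity), ← Real.mul_rpow (by positivity) (by positivity)]
      exact Real.rpow_le_rpow (by positivity) (by linarith) hθ0.le
    have h2 : 1 ≤ (n : ℝ) ^ (θ * θ) := Real.one_le_rpow hn1 (by positivity)
    rw [hT₁, Nat.cast_add, hC₁, add_mul]
    have := mul_le_mul_of_nonneg_left h2 hs0
    linarith
  have h2 : 1 ≤ (n : ℝ) ^ (θ * θ) := Real.one_le_rpow hn1 (by positivity)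
  have e : (n : ℝ) ^ (2 / (d : ℝ) ^ 2) = ((n : ℝ) ^ (θ * θ)) ^ 2 := by
    rw [← Real.rpow_natCast ((n : ℝ) ^ (θ * θ)), ← Real.rpow_mul (by positivity), hθ]
    congr 1
    push_cast
    field_simp
  rw [e]
  calc ((monoSolutionTriples p n φ).card : ℝ) ≤ 2 * ((T₁ : ℝ) + 1) ^ 2 := by exact_mod_cast hφ
    _ ≤ 2 * ((C₁ + 1) * (n : ℝ) ^ (θ * θ)) ^ 2 := by
        gcongr
        linarith
    _ = 2 * (C₁ + 1) ^ 2 * ((n : ℝ) ^ (θ * θ)) ^ 2 := by ring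

/-! ### Degree one -/

/-- Bound for the indices of a configuration. -/
def indexBound (a : ℤ) : ℤ := 6 * (a * (40 * a + 11)) + 200

/-- If `z` and `z + 2 s` have different colours, then there is a monochromatic solution
whose entries are linear forms in `z` and `s` with bounded coefficients. -/
theorem exists_solution_of_ne {a b z s : ℤ} {χ : ℤ → Bool} (ha : 1 ≤ a) (h2 : 2 ∣ a * z + b)
    (hs : |b| < s) (hz : 20 * a * indexBound a * s ≤ z) (hne : χ z ≠ χ (z + 2 * s)) :
    ∃ x y r i l : ℤ, (0 < x ∧ 0 < y ∧ 0 < r ∧ r ≤ 2 * z) ∧ (x ≠ y ∧ x ≠ r ∧ y ≠ r) ∧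
      x + y = a * r + b ∧ (χ x = χ r ∧ χ y = χ r) ∧ (|i| ≤ indexBound a ∧ |l| ≤ indexBound a) ∧
      i ≠ l ∧ r = z + 2 * s * l ∧ (x = z + 2 * s * i ∨ 2 * x = a * z + b + 2 * a * s * i) := by
  by_contra hcon
  -- Chosen so that the last use of `quad`, with `l' = 40 a + 1`, has `i' = c₂ - 11`.
  set c₂ : ℤ := a * (40 * a + 11) with hc₂
  have hc₂0 : 51 * a ≤ c₂ := by nlinarith
  set N : ℤ := indexBound a with hN
  have hNc : N = 6 * c₂ + 200 := rfl
  have hs0 : 0 < s := (abs_nonneg b).trans_lt hs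
  obtain ⟨hb1, hb2⟩ := abs_lt.1 hs
  have hNs : 0 < N * s := by
    have : 0 < N := by omega
    positivity
  have haNs : N * s ≤ a * (N * s) := le_mul_of_one_le_left hNs.le ha
  have hz' : 20 * (a * (N * s)) ≤ z := by linarith
  have hsN : s ≤ N * s := le_mul_of_one_le_left hs0.le (by omega)
  have idx : ∀ k : ℤ, |k| ≤ N → -(N * s) ≤ s * k ∧ s * k ≤ N * s := by
    intro k hk
    obtain ⟨h1, h2⟩ := abs_le.1 hk
    constructor <;> nlinarith
  have aidx : ∀ k : ℤ, |k| ≤ N → -(a * (N * s)) ≤ a * (s * k) ∧ a * (s * k) ≤ a * (N * s) := by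
    intro k hk
    obtain ⟨h1, h2⟩ := idx k hk
    constructor <;> nlinarith
  have hZpos : ∀ l, |l| ≤ N → 0 < z + 2 * s * l ∧ z + 2 * s * l ≤ 2 * z := by
    intro l hl
    obtain ⟨h1, h2⟩ := idx l hl
    rw [mul_assoc]
    omega
  obtain ⟨w, hw⟩ := h2
  set ζ : ℤ → Bool := fun l => χ (z + 2 * s * l) with hζ
  -- Since `2 w = a z + b`, terms with indices `i`, `j` here sum to `a (z + 2 s l) + b` exactly when
  -- `i + j = 2 l`. The coefficients disappear and `Avoids.no_alternation` applies with `q l = 2 l`.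
  set ξ : ℤ → Bool := fun k => χ (w + a * (s * k)) with hξ
  have hζ0 : ζ 0 ≠ ζ 1 := by simpa [hζ] using hne
  have haz : z ≤ a * z := le_mul_of_one_le_left (by omega) ha
  have noX : ∀ l i j, |l| ≤ N → |i| ≤ N → |j| ≤ N → i ≠ j → i + j = 2 * l →
      ¬ (ξ i = ζ l ∧ ξ j = ζ l) := by
    rintro l i j hl hi hj hij hsum hcol
    have hil : i ≠ l := by omega
    have hjl : j ≠ l := by omega
    have hpos : ∀ k, |k| ≤ N → 0 < w + a * (s * k) := by
      intro k hk
      have := (aidx k hk).1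
      nlinarith
    have hneq : ∀ k, |k| ≤ N → k ≠ l → w + a * (s * k) ≠ z + 2 * s * l := by
      intro k hk hkl heq
      have e : (a - 2) * z + b + 2 * (a * (s * k)) - 4 * (s * l) = 0 := by linarith
      have i1 := aidx k hk
      have i2 := idx l hl
      rcases lt_trichotomy a 2 with h | h | h
      · obtain rfl : a = 1 := by omega
        omega
      · subst h
        have : b = 4 * (s * (l - k)) := by linarith
        rcases lt_or_gt_of_ne hkl with h | h
        · have : s * 1 ≤ s * (l - k) := mul_le_mul_of_nonneg_left (by omega) hs0.le
          omega
        · have : s * (l - k) ≤ s * (-1) := mul_le_mul_of_nonneg_left (by omega) hs0.le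
          omega
      · have : 1 * z ≤ (a - 2) * z := mul_le_mul_of_nonneg_right (by omega) (by omega)
        omega
    refine hcon ⟨w + a * (s * i), w + a * (s * j), z + 2 * s * l, i, l,
      ⟨hpos i hi, hpos j hj, hZpos l hl⟩, ⟨?_, hneq i hi hil, hneq j hj hjl⟩, ?_, hcol, ⟨hi, hl⟩,
      hil, rfl, Or.inr ?_⟩
    · intro h
      have h1 : a * (s * i) = a * (s * j) := by linarith
      exact hij (mul_left_cancel₀ hs0.ne' (mul_left_cancel₀ (by omega) h1))
    · have : a * (s * i) + a * (s * j) = a * (s * (2 * l)) := by rw [← hsum]; ring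
      linarith
    · rw [hw]
      ring
  have alt : ∀ l₁ l₂ l₃, -11 ≤ l₁ → l₃ ≤ c₂ → 8 ≤ l₂ - l₁ → l₂ - l₁ + 8 ≤ l₃ - l₂ →
      ζ l₁ ≠ ζ l₂ → ζ l₁ = ζ l₃ → False := by
    intro l₁ l₂ l₃ h1 h2 h3 h4 h5 h6
    have hav : Avoids ξ ζ (fun l => 2 * l) (-(4 * c₂ + 100)) {l | l₁ ≤ l ∧ l ≤ l₃} := by
      intro l hl x y hx hy hxy hsum
      obtain ⟨hl1, hl2⟩ := hl
      dsimp only at hsum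
      exact noX l x y (abs_le.2 ⟨by omega, by omega⟩) (abs_le.2 ⟨by omega, by omega⟩)
        (abs_le.2 ⟨by omega, by omega⟩) hxy hsum
    refine hav.no_alternation (a := l₁) (b := l₂) (c := l₃) (Q := 2) (R := 2 * (l₃ - l₁))
      ⟨le_rfl, by omega⟩ ⟨by omega, by omega⟩ ⟨by omega, le_rfl⟩ h5 h6
      (fun l hl => by have := hl.1; omega)
      (fun l hl => by have := hl.2; omega) ?_ (by omega)
      (by omega) (by norm_num) (by omega)
    intro P _ hdvd
    have := hdvd (l₁ + 1) ⟨by omega, by omega⟩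
    rw [show 2 * (l₁ + 1) - 2 * l₁ = 2 by ring] at this
    exact ⟨Int.le_of_dvd (by norm_num) this, l₁, by simp⟩
  -- One `y` completes both index pairs `(-11, -10)` and `(i', l')`; when these pairs are
  -- monochromatic of opposite colours, neither colour is left for `y`.
  have quad : ∀ l', 9 ≤ l' → l' ≤ c₂ → l' ≠ -11 + a * (l' + 10) → -11 + a * (l' + 10) ≤ c₂ →
      ζ (-10) = ζ (-11) → ζ (-10) ≠ ζ l' → ζ l' = ζ (-11 + a * (l' + 10)) → False := by
    intro l' h1 h2 h3 h4 c1 c3 c4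
    set i' := -11 + a * (l' + 10) with hi'
    have hi8 : 8 ≤ i' := by nlinarith
    set y := (a - 1) * z + b + 2 * s * (11 - 10 * a) with hy
    have bnd : ∀ k, -11 ≤ k → k ≤ c₂ → |k| ≤ N := fun k h h' => abs_le.2 ⟨by omega, by omega⟩
    have has : a * s ≤ a * (N * s) := mul_le_mul_of_nonneg_left hsN (by omega)
    have hypos : 0 < y := by
      rw [hy]
      rcases ha.eq_or_lt with rfl | h
      · omega
      · have : 1 * z ≤ (a - 1) * z := mul_le_mul_of_nonneg_right (by omega) (by omega)
        nlinarith
    -- For `a = 2` one has `y = z + 2 s (-9) + b`, so index `-9` may coincide with `y`; other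
    -- indices are ruled out by `|b| < s`.
    have hyne : ∀ k, -11 ≤ k → k ≤ c₂ → k ≠ -9 → y ≠ z + 2 * s * k := by
      intro k hk1 hk2 hk3 heq
      have i2 := idx k (bnd k hk1 hk2)
      have e : (a - 2) * z + b + 22 * s - 20 * (a * s) - 2 * (s * k) = 0 := by
        rw [hy] at heq
        linarith
      rcases lt_trichotomy a 2 with h | h | h
      · obtain rfl : a = 1 := by omega
        omega
      · subst h
        have e' : b = 2 * (s * (k + 9)) := by linarith
        rcases lt_or_gt_of_ne hk3 with h | h
        · have : s * (k + 9) ≤ s * (-1) := mul_le_mul_of_nonneg_left (by omega) hs0.le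
          omega
        · have : s * 1 ≤ s * (k + 9) := mul_le_mul_of_nonneg_left (by omega) hs0.le
          omega
      · have : 1 * z ≤ (a - 2) * z := mul_le_mul_of_nonneg_right (by omega) (by omega)
        have : N * s ≥ 1000 * s := mul_le_mul_of_nonneg_right (by omega) hs0.le
        have : a * (1000 * s) ≤ a * (N * s) := mul_le_mul_of_nonneg_left this (by omega)
        nlinarith
    have hinj : ∀ k k' : ℤ, k ≠ k' → z + 2 * s * k ≠ z + 2 * s * k' := by
      intro k k' hk h
      exact hk (mul_left_cancel₀ (by omega : 2 * s ≠ 0) (by linarith))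
    have use : ∀ i l, -11 ≤ i → i ≤ c₂ → -11 ≤ l → l ≤ c₂ → i ≠ -9 → l ≠ -9 → i ≠ l →
        z + 2 * s * i + y = a * (z + 2 * s * l) + b → ¬ (ζ i = ζ l ∧ χ y = ζ l) := by
      intro i l hi1 hi2 hl1 hl2 hi hl hil hsum hcol
      exact hcon ⟨z + 2 * s * i, y, z + 2 * s * l, i, l, ⟨(hZpos i (bnd i hi1 hi2)).1, hypos,
        hZpos l (bnd l hl1 hl2)⟩, ⟨(hyne i hi1 hi2 hi).symm, hinj i l hil, hyne l hl1 hl2 hl⟩,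
        hsum, hcol, ⟨bnd i hi1 hi2, bnd l hl1 hl2⟩, hil, rfl, Or.inl rfl⟩
    have u1 := use (-11) (-10) (by norm_num) (by omega) (by norm_num) (by omega) (by norm_num)
      (by norm_num) (by norm_num) (by rw [hy]; ring)
    have u2 := use i' l' (by omega) h4 (by omega) h2 (by omega) (by omega) h3.symm
      (by rw [hy, hi']; ring)
    revert c1 c3 c4 u1 u2
    cases ζ (-10) <;> cases ζ (-11) <;> cases ζ l' <;> cases ζ i' <;> cases χ y <;> simp
  -- Whether the colour of index 0 recurs far out or not, `alt` forces indices `-10`, `-11` to have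
  -- the colour opposite to that of suitable `l'`, `i'`.
  by_cases hcase : ∃ c, 40 * a ≤ c ∧ c ≤ c₂ ∧ ζ c = ζ 0
  · obtain ⟨c, hc1, hc2, hc3⟩ := hcase
    have neg : ∀ j, 10 ≤ j → j ≤ 11 → ζ (-j) ≠ ζ 0 := fun j h1 h2 h =>
      alt (-j) 1 c (by omega) hc2 (by omega) (by omega) (by rw [h]; exact hζ0) (by rw [h, hc3])
    have pos : ∀ j, 8 ≤ j → 2 * j + 8 ≤ c → ζ j = ζ 0 := by
      intro j h1 h2
      by_contra h
      exact alt 0 j c (by omega) hc2 (by omega) (by omega) (Ne.symm h) hc3.symm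
    have n10 := neg 10 (by norm_num) (by norm_num)
    have n11 := neg 11 (by norm_num) (by norm_num)
    have p9 := pos 9 (by norm_num) (by omega)
    have pi := pos (-11 + a * (9 + 10)) (by omega) (by omega)
    refine quad 9 le_rfl (by omega) (by omega) (by omega) ?_ ?_ ?_
    · revert n10 n11
      cases ζ (-10) <;> cases ζ (-11) <;> cases ζ 0 <;> simp
    · rw [p9]
      exact n10
    · rw [p9, pi]
  · push Not at hcase
    have neg : ∀ j, 10 ≤ j → j ≤ 11 → ζ (-j) = ζ 0 := by
      intro j h1 h2
      by_contra h
      have h40 := hcase (40 * a) le_rfl (by omega)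
      refine alt (-j) 0 (40 * a) (by omega) (by omega) (by omega) (by omega) h ?_
      revert h h40
      cases ζ (-j) <;> cases ζ (40 * a) <;> cases ζ 0 <;> simp
    have n10 := neg 10 (by norm_num) (by norm_num)
    have n11 := neg 11 (by norm_num) (by norm_num)
    have hi : -11 + a * (40 * a + 1 + 10) = c₂ - 11 := by rw [hc₂]; ring
    have hi40 : 40 * a ≤ c₂ - 11 := by omega
    have hcl := hcase (40 * a + 1) (by omega) (by omega)
    have hci := hcase (c₂ - 11) hi40 (by omega)
    refine quad (40 * a + 1) (by omega) (by omega) ?_ (by omega) ?_ ?_ ?_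
    · rw [hi]
      rcases ha.eq_or_lt with h | h
      · rw [hc₂, ← h]
        norm_num
      · have : 91 * a ≤ c₂ := by nlinarith
        omega
    · rw [n10, n11]
    · rw [n10]
      exact hcl.symm
    · rw [hi]
      revert hcl hci
      cases ζ (40 * a + 1) <;> cases ζ (c₂ - 11) <;> cases ζ 0 <;> simp

/-- The solution, the indices `i ≠ l` and the form of `x` determine `(m, s)`: the linear forms for
`x` and `r` are independent because `i ≠ l`. -/
theorem card_color_changes_le {p : Polynomial ℤ} {a b ρ m₁ m₂ s₀ s₁ : ℤ} {n : ℕ} {φ : ℕ → Bool}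
    (hp : ∀ z, p.eval z = a * z + b) (ha : 1 ≤ a) (hρ : 2 ∣ a * ρ + b) (hs₀ : |b| < s₀)
    (hm₁ : 20 * a * indexBound a * s₁ ≤ ρ + 2 * m₁) (hn : (2 * a + 1) * (ρ + 2 * m₂) ≤ n) :
    ({q ∈ Finset.Icc m₁ m₂ ×ˢ Finset.Icc s₀ s₁ |
      intColor φ (ρ + 2 * q.1) ≠ intColor φ (ρ + 2 * (q.1 + q.2))} : Finset (ℤ × ℤ)).card ≤
      (distinctTriples p n φ).card * (2 * (2 * (indexBound a).toNat + 1) ^ 2) := by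
  set B : Finset (ℤ × ℤ) := {q ∈ Finset.Icc m₁ m₂ ×ˢ Finset.Icc s₀ s₁ |
      intColor φ (ρ + 2 * q.1) ≠ intColor φ (ρ + 2 * (q.1 + q.2))} with hB
  set N := indexBound a with hN
  have hN0 : 0 < N := by
    have : 0 < a := ha
    rw [hN, indexBound]
    positivity
  have hmem : ∀ q ∈ B, (m₁ ≤ q.1 ∧ q.1 ≤ m₂) ∧ (s₀ ≤ q.2 ∧ q.2 ≤ s₁) ∧
      intColor φ (ρ + 2 * q.1) ≠ intColor φ (ρ + 2 * q.1 + 2 * q.2) := by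
    intro q hq
    rw [hB, Finset.mem_filter, Finset.mem_product, Finset.mem_Icc, Finset.mem_Icc] at hq
    rw [add_assoc, ← mul_add]
    exact ⟨hq.1.1, hq.1.2, hq.2⟩
  have hsol : ∀ q ∈ B, _ := fun q hq => by
    obtain ⟨⟨h1, h2⟩, ⟨h3, h4⟩, h5⟩ := hmem q hq
    have hle : 20 * a * N * q.2 ≤ 20 * a * N * s₁ :=
      mul_le_mul_of_nonneg_left h4 (by have : 0 < a := ha
                                       positivity)
    exact exists_solution_of_ne ha (z := ρ + 2 * q.1) (s := q.2) (b := b) (χ := intColor φ)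
      (by have : a * (ρ + 2 * q.1) + b = (a * ρ + b) + 2 * (a * q.1) := by ring
          rw [this]
          exact dvd_add hρ (dvd_mul_right _ _)) (hs₀.trans_le h3)
      (hle.trans (hm₁.trans (by omega))) h5
  choose! x y r i l hpos hdist hsum hcol hil hne hr hx using hsol
  set F : ℤ × ℤ → (ℕ × ℕ × ℕ) × (Bool × ℤ × ℤ) := fun q =>
    (((x q).toNat, (y q).toNat, (r q).toNat),
      (decide (x q = ρ + 2 * q.1 + 2 * q.2 * i q), i q, l q)) with hF
  have hcard : (distinctTriples p n φ ×ˢ ((Finset.univ : Finset Bool) ×ˢ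
      (Finset.Icc (-N) N ×ˢ Finset.Icc (-N) N))).card
      = (distinctTriples p n φ).card * (2 * (2 * N.toNat + 1) ^ 2) := by
    simp only [Finset.card_product, Int.card_Icc, Finset.card_univ, Fintype.card_bool]
    rw [show (N + 1 - -N).toNat = 2 * N.toNat + 1 by omega, sq]
  rw [← hcard]
  refine Finset.card_le_card_of_injOn F ?_ ?_
  · intro q hq
    obtain ⟨⟨h1, h2⟩, ⟨h3, h4⟩, h5⟩ := hmem q hq
    obtain ⟨p1, p2, p3, p4⟩ := hpos q hq
    obtain ⟨d1, d2, d3⟩ := hdist q hq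
    obtain ⟨c1, c2⟩ := hcol q hq
    obtain ⟨i1, i2⟩ := hil q hq
    have hb := abs_lt.1 (hs₀.trans_le h3)
    have hz0 : 0 < ρ + 2 * q.1 := by omega
    have hqz : q.2 ≤ ρ + 2 * q.1 := by
      have : 1 ≤ a * N := one_le_mul_of_one_le_of_one_le ha hN0
      have h6 : 1 * s₁ ≤ 20 * (a * N) * s₁ := mul_le_mul_of_nonneg_right (by omega) (by omega)
      have h7 : 20 * (a * N) * s₁ = 20 * a * N * s₁ := by ring
      omega
    have hpn : a * r q + b ≤ n := by
      have h6 : a * r q ≤ a * (2 * (ρ + 2 * q.1)) := mul_le_mul_of_nonneg_left p4 (by omega)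
      have h7 : (2 * a + 1) * (ρ + 2 * q.1) ≤ (2 * a + 1) * (ρ + 2 * m₂) :=
        mul_le_mul_of_nonneg_left (by omega) (by omega)
      linarith
    have hrn : r q ≤ n := by
      have h6 : 2 * (ρ + 2 * m₂) ≤ (2 * a + 1) * (ρ + 2 * m₂) :=
        mul_le_mul_of_nonneg_right (by omega) (by omega)
      omega
    have hs := hsum q hq
    rw [Finset.mem_coe, Finset.mem_product, Finset.mem_product, Finset.mem_product]
    refine ⟨?_, Finset.mem_univ _, Finset.mem_Icc.2 (abs_le.1 i1), Finset.mem_Icc.2 (abs_le.1 i2)⟩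
    rw [mem_distinctTriples, hp]
    refine ⟨⟨⟨by omega, by omega⟩, ⟨by omega, by omega⟩, by omega, by omega⟩,
      ⟨c1.trans c2.symm, c2, ?_⟩, by omega, by omega, by omega⟩
    rw [Int.toNat_of_nonneg p1.le, Int.toNat_of_nonneg p2.le, Int.toNat_of_nonneg p3.le, hs]
  · intro q hq q' hq' heq
    obtain ⟨p1, p2, p3, p4⟩ := hpos q hq
    obtain ⟨p1', p2', p3', p4'⟩ := hpos q' hq'
    have hr1 := hr q hq
    have hr2 := hr q' hq'
    have hx1 := hx q hq
    have hx2 := hx q' hq'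
    have hnil := hne q hq
    simp only [hF, Prod.mk.injEq, decide_eq_decide] at heq
    obtain ⟨⟨ex, ey, er⟩, et, ei, el⟩ := heq
    have ex' : x q = x q' := by omega
    have er' : r q = r q' := by omega
    rw [← ei] at hx2 et
    rw [← el] at hr2
    rw [← ex'] at hx2 et
    rw [← er'] at hr2
    have hs : q.2 = q'.2 := by
      by_cases ht : x q = ρ + 2 * q.1 + 2 * q.2 * i q
      · have ht' := et.1 ht
        have h1 : (2 * (i q - l q)) * q.2 = (2 * (i q - l q)) * q'.2 := by linarith
        exact mul_left_cancel₀ (by omega) h1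
      · have k1 := hx1.resolve_left ht
        have k2 := hx2.resolve_left fun h => ht (et.2 h)
        have h1 : (2 * a * (i q - l q)) * q.2 = (2 * a * (i q - l q)) * q'.2 := by
          have e1 : a * r q = a * (ρ + 2 * q.1 + 2 * q.2 * l q) := by rw [← hr1]
          have e2 : a * r q = a * (ρ + 2 * q'.1 + 2 * q'.2 * l q) := by rw [← hr2]
          linarith
        exact mul_left_cancel₀ (mul_ne_zero (by omega) (by omega)) h1
    have hm : q.1 = q'.1 := by
      rw [hs] at hr1
      omega
    exact Prod.ext hm hs

/-! ### Degree one: few changes of colour give many solutions -/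

/-- The number of changes of colour at distance `s ∈ [s₀, s₁]` from `m`. -/
noncomputable def changesAt (ψ : ℤ → Bool) (s₀ s₁ m : ℤ) : Finset ℤ :=
  {s ∈ Finset.Icc s₀ s₁ | ψ m ≠ ψ (m + s)}

/-- If `m` and `m'` differ in colour, every point ahead of both differs from one of them. This gives
at least `3 g / 4` changes in total, against fewer than `g / 4`. -/
theorem color_eq_of_few_changes {ψ : ℤ → Bool} {s₀ g m m' : ℤ}
    (hs₀ : 4 * s₀ ≤ g) (hm : m ≤ m') (hm' : m' ≤ m + g)
    (h : 8 * ((changesAt ψ s₀ (2 * g) m).card : ℤ) < g)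
    (h' : 8 * ((changesAt ψ s₀ (2 * g) m').card : ℤ) < g) : ψ m = ψ m' := by
  by_contra hne
  set t := m' - m with ht
  have hsub : Finset.Icc (s₀ + t) (2 * g) ⊆
      changesAt ψ s₀ (2 * g) m ∪ (changesAt ψ s₀ (2 * g) m').image (· + t) := by
    intro s hs
    rw [Finset.mem_Icc] at hs
    rw [Finset.mem_union]
    by_cases hc : ψ m = ψ (m + s)
    · right
      refine Finset.mem_image.2 ⟨s - t, ?_, by ring⟩
      rw [changesAt, Finset.mem_filter, Finset.mem_Icc]
      refine ⟨⟨by omega, by omega⟩, ?_⟩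
      rw [show m' + (s - t) = m + s by rw [ht]; ring, ← hc]
      exact Ne.symm hne
    · left
      rw [changesAt, Finset.mem_filter, Finset.mem_Icc]
      exact ⟨⟨by omega, by omega⟩, hc⟩
  have h1 := (Finset.card_le_card hsub).trans (Finset.card_union_le _ _)
  have h2 : ((changesAt ψ s₀ (2 * g) m').image (· + t)).card ≤ (changesAt ψ s₀ (2 * g) m').card :=
    Finset.card_image_le
  rw [Int.card_Icc] at h1
  omega

/-- As `E` is smaller than `g`, unexceptional elements can be chained with gaps of at most `g`. -/
theorem color_eq_of_few_exceptions {ψ : ℤ → Bool} {s₀ g m₁ m₂ : ℤ} (hg : 0 < g)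
    (hs₀ : 4 * s₀ ≤ g) {E : Finset ℤ} (hE : 8 * (E.card : ℤ) ≤ g)
    (hEmem : ∀ m, m₁ ≤ m → m ≤ m₂ → m ∉ E → 8 * ((changesAt ψ s₀ (2 * g) m).card : ℤ) < g)
    {m m' : ℤ} (hm : m₁ ≤ m) (hmm : m ≤ m') (hm' : m' ≤ m₂) (hmE : m ∉ E) (hmE' : m' ∉ E) :
    ψ m = ψ m' := by
  obtain ⟨k, hk⟩ : ∃ k : ℕ, m' - m ≤ k := ⟨(m' - m).toNat, by omega⟩
  induction k using Nat.strong_induction_on generalizing m with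
  | _ k ih =>
    by_cases hle : m' ≤ m + g
    · exact color_eq_of_few_changes hs₀ hmm hle (hEmem m hm (by omega) hmE)
        (hEmem m' (by omega) hm' hmE')
    · obtain ⟨c, hc1, hc2, hc3⟩ := exists_mem_Icc_notMem E (G := E.card) le_rfl (m + 1)
      have e1 := color_eq_of_few_changes (ψ := ψ) hs₀ (by omega : m ≤ c) (by omega)
        (hEmem m hm (by omega) hmE) (hEmem c (by omega) (by omega) hc3)
      exact e1.trans (ih (k - 1) (by omega) (by omega) (by omega) hc3 (by omega))

theorem exists_sq_le_mul_card (p : Polynomial ℤ) (a b : ℤ) (hp : ∀ z, p.eval z = a * z + b)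
    (ha : 1 ≤ a) (hpar : 2 ∣ p.eval 1 * p.eval 2) :
    ∃ D k g₀ : ℕ, 1 ≤ D ∧ ∀ g n : ℕ, g₀ ≤ g → D * g ≤ n → ∀ φ : ℕ → Bool,
      g ^ 2 ≤ k * (distinctTriples p n φ).card := by
  -- The parity condition selects a class `ρ + 2 m` on which `p` is even; there the equation reads
  -- `x + y = a r + b'` in the parameters.
  obtain ⟨ρ, hρ0, hρ2, hρ⟩ : ∃ ρ : ℤ, 1 ≤ ρ ∧ ρ ≤ 2 ∧ 2 ∣ a * ρ + b := by
    rcases Int.prime_two.dvd_or_dvd hpar with h | h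
    · exact ⟨1, by norm_num, by norm_num, by rwa [hp] at h⟩
    · exact ⟨2, by norm_num, by norm_num, by rwa [hp] at h⟩
  obtain ⟨b', hb'⟩ : (2 : ℤ) ∣ a * ρ + b - 2 * ρ := dvd_sub hρ (dvd_mul_right _ _)
  set N := indexBound a with hN
  have hN200 : 200 ≤ N := by
    rw [hN, indexBound]
    nlinarith
  set Λ : ℤ := 20 * a * N with hΛ
  have hΛ0 : 4000 ≤ Λ := by
    have : 1 * 200 ≤ a * N := mul_le_mul ha hN200 (by norm_num) (by omega)
    have : Λ = 20 * (a * N) := by rw [hΛ]; ring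
    omega
  set C₁ : ℕ := 2 * (2 * N.toNat + 1) ^ 2 with hC₁
  have hC₁0 : 1 ≤ C₁ := Nat.one_le_iff_ne_zero.2 (by positivity)
  refine ⟨((2 * a + 1) * (12 * a * Λ)).toNat, 64 * C₁, (4 * (|b| + 1) + |b'| + 8).toNat, ?_, ?_⟩
  · have : 0 < (2 * a + 1) * (12 * a * Λ) := by
      have : 0 < a := ha
      positivity
    omega
  intro g n hg hn φ
  by_contra hcon
  rw [not_le] at hcon
  have hg' : 4 * (|b| + 1) + |b'| + 8 ≤ g := by
    have := abs_nonneg b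
    have := abs_nonneg b'
    omega
  have hb0 := abs_nonneg b
  have hb'0 := abs_nonneg b'
  obtain ⟨hb'1, hb'2⟩ : -(g : ℤ) ≤ b' ∧ b' ≤ g := abs_le.1 (by omega)
  have hn' : (2 * a + 1) * (12 * a * Λ) * g ≤ n := by
    have h0 : 0 ≤ (2 * a + 1) * (12 * a * Λ) := by positivity
    rw [← Int.toNat_of_nonneg h0]
    exact_mod_cast hn
  -- `m₁` makes `z` large enough for distances `s ≤ 2 g`. With `r` near `3 m₁` and `x` near `m₁`,
  -- the partner `a r + b' - x` stays below `m₂ = 5 a m₁`.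
  set m₁ : ℤ := Λ * g with hm₁
  set m₂ : ℤ := 5 * (a * m₁) with hm₂
  have hm₁g : 4000 * (g : ℤ) ≤ m₁ := mul_le_mul_of_nonneg_right hΛ0 (by positivity)
  have ham₁ : m₁ ≤ a * m₁ := le_mul_of_one_le_left (by omega) ha
  set T := (distinctTriples p n φ).card with hT
  set ψ : ℤ → Bool := fun m => intColor φ (ρ + 2 * m) with hψ
  set s₀ : ℤ := |b| + 1 with hs₀
  have hn2 : (2 * a + 1) * (ρ + 2 * m₂) ≤ n := by
    refine le_trans ?_ hn'
    rw [mul_assoc]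
    refine mul_le_mul_of_nonneg_left ?_ (by omega)
    have : 12 * a * Λ * g = 12 * (a * m₁) := by rw [hm₁]; ring
    omega
  have hbad := card_color_changes_le (p := p) (n := n) (φ := φ) (m₁ := m₁) (m₂ := m₂) (s₀ := s₀)
    (s₁ := 2 * g) hp ha hρ (by omega)
    (by rw [← hN, ← hΛ, mul_left_comm, ← hm₁]; omega) hn2
  rw [← hT, ← hN, ← hC₁] at hbad
  set E : Finset ℤ := {m ∈ Finset.Icc m₁ m₂ | (g : ℤ) ≤ 8 * ((changesAt ψ s₀ (2 * g) m).card : ℤ)}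
    with hE
  -- Markov's inequality: each exceptional `m` accounts for at least `g / 8` changes, and fewer than
  -- `g² / 64` exist.
  have hEcard : 8 * E.card ≤ g := by
    have hfib : (({q ∈ Finset.Icc m₁ m₂ ×ˢ Finset.Icc s₀ (2 * (g : ℤ)) |
        intColor φ (ρ + 2 * q.1) ≠ intColor φ (ρ + 2 * (q.1 + q.2))} : Finset (ℤ × ℤ)).card)
        = ∑ m ∈ Finset.Icc m₁ m₂, (changesAt ψ s₀ (2 * g) m).card := by
      rw [Finset.card_filter, Finset.sum_product]
      refine Finset.sum_congr rfl fun m _ => ?_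
      rw [changesAt, Finset.card_filter]
    have h1 : E.card * g ≤ ∑ m ∈ E, 8 * (changesAt ψ s₀ (2 * g) m).card := by
      rw [← smul_eq_mul]
      refine Finset.card_nsmul_le_sum _ _ _ fun m hm => ?_
      have := (Finset.mem_filter.1 hm).2
      exact_mod_cast this
    have h2 : ∑ m ∈ E, 8 * (changesAt ψ s₀ (2 * g) m).card
        ≤ 8 * ∑ m ∈ Finset.Icc m₁ m₂, (changesAt ψ s₀ (2 * g) m).card := by
      rw [← Finset.mul_sum]
      exact Nat.mul_le_mul_left _ (Finset.sum_le_sum_of_subset (Finset.filter_subset _ _))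
    rw [← hfib] at h2
    have h3 : 8 * E.card * g ≤ g * g := by nlinarith
    exact Nat.le_of_mul_le_mul_right h3 (by omega)
  have hcol : ∀ m m', m₁ ≤ m → m ≤ m₂ → m ∉ E → m₁ ≤ m' → m' ≤ m₂ → m' ∉ E → ψ m = ψ m' := by
    have key := fun {m m' : ℤ} => color_eq_of_few_exceptions (ψ := ψ) (s₀ := s₀) (g := g)
      (m₁ := m₁) (m₂ := m₂) (by omega) (by omega) (E := E) (by exact_mod_cast hEcard)
      (fun m h1 h2 h3 => by
        by_contra hc
        exact h3 (Finset.mem_filter.2 ⟨Finset.mem_Icc.2 ⟨h1, h2⟩, by omega⟩)) (m := m) (m' := m')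
    intro m m' h1 h2 h3 h4 h5 h6
    rcases le_total m m' with h | h
    · exact key h1 h h5 h3 h6
    · exact (key h4 h h2 h6 h3).symm
  -- the solutions among the unexceptional elements
  set A : Finset ℤ := Finset.Icc (3 * m₁) (3 * m₁ + g) \ E with hA
  set S : Finset (ℤ × ℤ) := A.biUnion fun r => ((Finset.Icc m₁ (m₁ + g) \
    (E ∪ E.image fun y => a * r + b' - y)).image fun x => (r, x)) with hS
  have hSmem : ∀ q ∈ S, (3 * m₁ ≤ q.1 ∧ q.1 ≤ 3 * m₁ + g ∧ q.1 ∉ E) ∧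
      (m₁ ≤ q.2 ∧ q.2 ≤ m₁ + g ∧ q.2 ∉ E) ∧ a * q.1 + b' - q.2 ∉ E := by
    intro q hq
    rw [hS, Finset.mem_biUnion] at hq
    obtain ⟨r, hr, hq⟩ := hq
    obtain ⟨x, hx, rfl⟩ := Finset.mem_image.1 hq
    rw [hA, Finset.mem_sdiff, Finset.mem_Icc] at hr
    rw [Finset.mem_sdiff, Finset.mem_Icc, Finset.mem_union, not_or] at hx
    exact ⟨⟨hr.1.1, hr.1.2, hr.2⟩, ⟨hx.1.1, hx.1.2, hx.2.1⟩, fun h =>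
      hx.2.2 (Finset.mem_image.2 ⟨_, h, by ring⟩)⟩
  have hScard : g * g ≤ 2 * S.card := by
    have hAc : 7 * g ≤ 8 * A.card := by
      have := Finset.le_card_sdiff E (Finset.Icc (3 * m₁) (3 * m₁ + g))
      rw [Int.card_Icc] at this
      rw [hA]
      omega
    have hdisj : S.card = ∑ r ∈ A, ((Finset.Icc m₁ (m₁ + g) \
        (E ∪ E.image fun y => a * r + b' - y)).image fun x => (r, x)).card := by
      refine Finset.card_biUnion fun r _ r' _ hrr => ?_
      rw [Function.onFun, Finset.disjoint_left]
      intro q h1 h2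
      obtain ⟨x, -, rfl⟩ := Finset.mem_image.1 h1
      obtain ⟨x', -, h⟩ := Finset.mem_image.1 h2
      exact hrr (Prod.ext_iff.1 h).1.symm
    have hlow : A.card * (3 * g) ≤ ∑ r ∈ A, 4 * ((Finset.Icc m₁ (m₁ + g) \
        (E ∪ E.image fun y => a * r + b' - y)).image fun x => (r, x)).card := by
      rw [← smul_eq_mul]
      refine Finset.card_nsmul_le_sum _ _ _ fun r _ => ?_
      rw [Finset.card_image_of_injective _ (Prod.mk_right_injective r)]
      have h1 := Finset.le_card_sdiff (E ∪ E.image fun y => a * r + b' - y)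
        (Finset.Icc m₁ (m₁ + g))
      have h2 := Finset.card_union_le E (E.image fun y => a * r + b' - y)
      have h3 : (E.image fun y => a * r + b' - y).card ≤ E.card := Finset.card_image_le
      rw [Int.card_Icc] at h1
      omega
    rw [← Finset.mul_sum, ← hdisj] at hlow
    nlinarith
  have hST : S.card ≤ T := by
    refine Finset.card_le_card_of_injOn (fun q => ((ρ + 2 * q.2).toNat,
      (ρ + 2 * (a * q.1 + b' - q.2)).toNat, (ρ + 2 * q.1).toNat)) ?_ ?_
    · intro q hq
      obtain ⟨⟨r1, r2, r3⟩, ⟨x1, x2, x3⟩, y3⟩ := hSmem q hq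
      have ar1 : a * (3 * m₁) ≤ a * q.1 := mul_le_mul_of_nonneg_left r1 (by omega)
      have ar2 : a * q.1 ≤ a * (3 * m₁ + g) := mul_le_mul_of_nonneg_left r2 (by omega)
      have ar3 : a * (3 * m₁ + g) ≤ 4 * (a * m₁) := by
        have : a * (3 * m₁ + g) ≤ a * (4 * m₁) := mul_le_mul_of_nonneg_left (by omega) (by omega)
        linarith
      have ar1' : 3 * (a * m₁) ≤ a * q.1 := by linarith
      set y := a * q.1 + b' - q.2 with hy
      have y1 : m₁ + g < y := by omega
      have y2 : y ≤ m₂ := by omega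
      have hyr : y ≠ q.1 := by
        rcases ha.eq_or_lt with h | h
        · have : a * q.1 = q.1 := by rw [← h, one_mul]
          omega
        · have : 2 * q.1 ≤ a * q.1 := mul_le_mul_of_nonneg_right (by omega) (by omega)
          omega
      have hm₂n : ρ + 2 * m₂ ≤ n := by
        refine le_trans ?_ hn2
        exact le_mul_of_one_le_left (by omega) (by omega)
      have c1 : ψ q.2 = ψ y := hcol _ _ x1 (by omega) x3 (by omega) y2 y3
      have c2 : ψ y = ψ q.1 := hcol _ _ (by omega) y2 y3 (by omega) (by omega) r3
      rw [Finset.mem_coe, mem_distinctTriples, hp]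
      refine ⟨⟨⟨by omega, by omega⟩, ⟨by omega, by omega⟩, by omega, by omega⟩, ⟨c1, c2, ?_⟩,
        by omega, by omega, by omega⟩
      rw [Int.toNat_of_nonneg (by omega), Int.toNat_of_nonneg (by omega),
        Int.toNat_of_nonneg (by omega)]
      linarith
    · intro q hq q' hq' heq
      obtain ⟨⟨r1, r2, r3⟩, ⟨x1, x2, x3⟩, y3⟩ := hSmem q hq
      obtain ⟨⟨r1', r2', r3'⟩, ⟨x1', x2', x3'⟩, y3'⟩ := hSmem q' hq'
      simp only [Prod.mk.injEq] at heq
      exact Prod.ext (by omega) (by omega)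
  have : T ≤ C₁ * T := Nat.le_mul_of_pos_left _ (by omega)
  rw [sq] at hcon
  have : 64 * C₁ * T = 64 * (C₁ * T) := by ring
  have : 0 < g * g := Nat.mul_pos (by omega) (by omega)
  omega

open Filter in
theorem eventually_rpow_le_card_of_natDegree_one (p : Polynomial ℤ) (hdeg : p.natDegree = 1)
    (hlead : 0 < p.leadingCoeff) (hpar : 2 ∣ p.eval 1 * p.eval 2) {ε : ℝ} (hε : 0 < ε) :
    ∀ᶠ n : ℕ in atTop, ∀ φ : ℕ → Bool,
      (n : ℝ) ^ (2 - ε) ≤ ((monoSolutionSets p n φ).card : ℝ) := by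
  have hp : ∀ z, p.eval z = p.leadingCoeff * z + p.coeff 0 := fun z => by
    conv_lhs => rw [Polynomial.eq_X_add_C_of_natDegree_le_one hdeg.le]
    simp [Polynomial.leadingCoeff, hdeg]
  obtain ⟨D, k, g₀, hD, h⟩ := exists_sq_le_mul_card p _ _ hp hlead hpar
  have hlim : ∀ᶠ n : ℕ in atTop, (4 * D ^ 2 * k * 27 : ℝ) ≤ (n : ℝ) ^ ε :=
    ((tendsto_rpow_atTop hε).comp tendsto_natCast_atTop_atTop).eventually_ge_atTop _
  filter_upwards [hlim, eventually_ge_atTop (D * (g₀ + 1))] with n hn hnD φ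
  have hDn : D ≤ n := (Nat.le_mul_of_pos_right D (Nat.succ_pos g₀)).trans hnD
  have hg : g₀ + 1 ≤ n / D := (Nat.le_div_iff_mul_le hD).2 (by rwa [mul_comm])
  have h1 := h (n / D) n (by omega) (Nat.mul_div_le n D) φ
  have h2 := card_distinctTriples_le p n φ
  have hlt : n ≤ 2 * D * (n / D) := by
    have h3 := Nat.lt_mul_div_succ n hD
    have h4 : D * 1 ≤ D * (n / D) := Nat.mul_le_mul_left _ (by omega)
    linarith
  have hsq : n ^ 2 ≤ 4 * D ^ 2 * k * 27 * (monoSolutionSets p n φ).card :=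
    calc n ^ 2 ≤ (2 * D * (n / D)) ^ 2 := Nat.pow_le_pow_left hlt 2
      _ = 4 * D ^ 2 * (n / D) ^ 2 := by ring
      _ ≤ 4 * D ^ 2 * (k * (27 * (monoSolutionSets p n φ).card)) :=
        Nat.mul_le_mul_left _ (h1.trans (Nat.mul_le_mul_left _ h2))
      _ = _ := by ring
  have hn0 : (0 : ℝ) < n := by exact_mod_cast hD.trans hDn
  have hsq' : (n : ℝ) ^ 2 ≤ 4 * D ^ 2 * k * 27 * (monoSolutionSets p n φ).card := by
    exact_mod_cast hsq
  rw [Real.rpow_sub hn0, Real.rpow_two, div_le_iff₀ (Real.rpow_pos_of_pos hn0 _), mul_comm]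
  exact hsq'.trans (mul_le_mul_of_nonneg_right hn (Nat.cast_nonneg _))

theorem theorem1p1 (p : Polynomial ℤ) (d : ℕ) (hd : 1 ≤ d) (hdeg : p.natDegree = d)
    (hlead : 0 < p.leadingCoeff) (hpar : 2 ∣ p.eval 1 * p.eval 2) :
    (∃ e : ℕ → ℝ, Filter.Tendsto e Filter.atTop (nhds 0) ∧
      ∀ᶠ n : ℕ in Filter.atTop, ∀ φ : ℕ → Bool,
        (n : ℝ) ^ (2 / (d : ℝ) ^ 3 - e n) ≤ ((monoSolutionSets p n φ).card : ℝ)) ∧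
    (∃ C : ℝ, ∀ n : ℕ, 1 ≤ n → ∃ φ : ℕ → Bool,
      ((monoSolutionSets p n φ).card : ℝ) ≤ C * (n : ℝ) ^ (2 / (d : ℝ) ^ 2) ∧
      ((monoSolutionTriples p n φ).card : ℝ) ≤ C * (n : ℝ) ^ (2 / (d : ℝ) ^ 2)) := by
  constructor
  · refine exists_tendsto_zero_rpow_sub_le (2 / (d : ℝ) ^ 3)
      (fun n φ => (monoSolutionSets p n φ).card) fun ε hε => ?_
    rcases hd.eq_or_lt with rfl | hd2
    · simpa using eventually_rpow_le_card_of_natDegree_one p hdeg hlead hpar hε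
    · exact eventually_rpow_le_card_of_two_le p d hd2 hdeg hlead hpar hε
  · obtain ⟨C, hC⟩ := exists_coloring_card_le_rpow p d hd hdeg hlead
    refine ⟨C, fun n hn => ?_⟩
    obtain ⟨φ, hφ⟩ := hC n hn
    exact ⟨φ, (Nat.cast_le.2 (card_monoSolutionSets_le p n φ)).trans hφ, hφ⟩
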